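/- **Setting.** Let $d,m\ge 0$ be integers. Write $B_R(y)$ for the closed Euclidean ball of radius $R$ about $y\in\mathbb R^d$. A set $S\subset\mathbb R^d$ is *Delone* if it is uniformly discrete and relatively dense. A *Delone multiset* is a family $\Lambda=(\Lambda_i)_{i\le m}$ of subsets of $\mathbb R^d$ such that each $\Lambda_i$ and $\operatorname{supp}(\Lambda)=\bigcup_{i}\Lambda_i$ are Delone. Translations, intersections with subsets of $\mathbb R^d$, and inclusions of such families are taken component by component. A *cluster* of $\Lambda$ is a family $P=(P_i)_{i\le m}$ of finite sets $P_i\subset\Lambda_i$. $\Lambda$ has *finite local complexity* (FLC) if for every $R>0$ there is a finite set $Y\subset\operatorname{supp}(\Lambda)$ such that for every $x\in\operatorname{supp}(\Lambda)$ there is $y\in Y$ with $B_R(x)\cap\Lambda=(B_R(y)\cap\Lambda)+(x-y)$. **The hull.** Let $X$ be the set of all Delone multisets each of whose clusters is a translate of a cluster of $\Lambda$, with the metric $$d(\Lambda_1,\Lambda_2)=\min\Bigl\{2^{-1/2},\ \inf\{\varepsilon>0:\ \exists\,x,y\in B_\varepsilon(0),\ B_{1/\varepsilon}(0)\cap(-x+\Lambda_1)=B_{1/\varepsilon}(0)\cap(-y+\Lambda_2)\}\Bigr\}.$$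 The *hull* $X_\Lambda$ is the closure of $\{-h+\Lambda:h\in\mathbb R^d\}$ in $X$; $\mathbb R^d$ acts on it by translations. The system $(X_\Lambda,\mathbb R^d)$ is *uniquely ergodic* if there is exactly one translation-invariant Borel probability measure on $X_\Lambda$. **Uniform cluster frequencies.** A *van Hove sequence* is a sequence $(F_n)_{n\ge1}$ of bounded Lebesgue measurable subsets of $\mathbb R^d$ of positive volume such that for all $r>0$ $$\lim_{n\to\infty}\frac{\operatorname{Vol}\{x:\operatorname{dist}(x,\partial F_n)\le r\}}{\operatorname{Vol}(F_n)}=0 .$$ For a cluster $P$ of $\Lambda$ having at least one point and a bounded set $A\subset\mathbb R^d$ let $L_P(A)=\#\{x\in\mathbb R^d: x+P\subset A\cap\Lambda\}$. $\Lambda$ has *uniform cluster frequencies* (UCF) relative to $(F_n)$ if for every such $P$ there is a number $\operatorname{freq}(P,\Lambda)$ with $$\frac{L_P(x+F_n)}{\operatorname{Vol}(F_n)}\longrightarrow\operatorname{freq}(P,\Lambda)\qquad(n\to\infty)\quad\text{uniformly in }x\in\mathbb R^d .$$ **Theorem 2.2.** Let $\Lambda$ be a Delone multiset with FLC, and let $(F_n)_{n\ge1}$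 be any van Hove sequence for $\mathbb R^d$. Then $(X_\Lambda,\mathbb R^d)$ is uniquely ergodic if and only if $\Lambda$ has uniform cluster frequencies relative to $(F_n)$. -/

import Mathlib

open Set Filter Topology MeasureTheory
open scoped Pointwise

noncomputable section

namespace DeloneHull

/-- Euclidean space `ℝ^d`. -/
abbrev Space (d : ℕ) : Type := EuclideanSpace ℝ (Fin d)

/-- An `m`-multiset in `ℝ^d`: a family of `m` subsets of `ℝ^d`, indexed by the colors. -/
abbrev Family (d m : ℕ) : Type := Fin m → Set (Space d)

variable {d m : ℕ}

/-- The translate `t + P = (t + P_i)_i`. -/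
def translate (t : Space d) (P : Family d m) : Family d m := fun i => t +ᵥ P i

/-- The restriction `A ∩ P = (A ∩ P_i)_i`. -/
def restrict (A : Set (Space d)) (P : Family d m) : Family d m := fun i => A ∩ P i

/-- The support `⋃ i, P_i`. -/
def supp (P : Family d m) : Set (Space d) := ⋃ i, P i

/-- A set is Delone if it is uniformly discrete and relatively dense. -/
def IsDelone (S : Set (Space d)) : Prop := ∃ D : Delone.DeloneSet (Space d), D.carrier = S

/-- A Delone `m`-multiset: every color class, and the support, is a Delone set. -/
@[ext]
structure DeloneMultiset (d m : ℕ) where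
  pts : Family d m
  isDelone_color : ∀ i, IsDelone (pts i)
  isDelone_supp : IsDelone (supp pts)

/-- `P` is a cluster of `Q`: `P_i ⊆ Q_i` is finite for all `i`. -/
def IsCluster (P Q : Family d m) : Prop := ∀ i, P i ⊆ Q i ∧ (P i).Finite

/-- Finite local complexity. -/
def HasFLC (Γ : DeloneMultiset d m) : Prop :=
  ∀ R : ℝ, 0 < R → ∃ Y : Set (Space d), Y.Finite ∧ Y ⊆ supp Γ.pts ∧
    ∀ x ∈ supp Γ.pts, ∃ y ∈ Y,
      restrict (Metric.closedBall x R) Γ.pts =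
        translate (x - y) (restrict (Metric.closedBall y R) Γ.pts)

/-! ### The metric on Delone multisets -/

/-- `B_{1/ε}(0) ∩ (-x + P) = B_{1/ε}(0) ∩ (-y + Q)` for some `x, y ∈ B_ε(0)`. -/
def Match (ε : ℝ) (P Q : Family d m) : Prop :=
  ∃ x ∈ Metric.closedBall (0 : Space d) ε, ∃ y ∈ Metric.closedBall (0 : Space d) ε,
    restrict (Metric.closedBall 0 (1 / ε)) (translate (-x) P) =
      restrict (Metric.closedBall 0 (1 / ε)) (translate (-y) Q)

/-- `min (inf {ε > 0 | Match ε P Q}) (2^{-1/2})`, written as a single infimum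
(which avoids any convention about the infimum of the empty set). -/
def hullDist (P Q : Family d m) : ℝ :=
  sInf (insert (√2)⁻¹ {ε : ℝ | 0 < ε ∧ Match ε P Q})

theorem mem_translate {t z : Space d} {P : Family d m} {i : Fin m} :
    z ∈ translate t P i ↔ z - t ∈ P i := by
  simp [translate, Set.mem_vadd_set_iff_neg_vadd_mem, sub_eq_neg_add]

theorem match_iff {ε : ℝ} {P Q : Family d m} :
    Match ε P Q ↔ ∃ x y : Space d, ‖x‖ ≤ ε ∧ ‖y‖ ≤ ε ∧
      ∀ i, ∀ z : Space d, ‖z‖ ≤ 1 / ε → (z + x ∈ P i ↔ z + y ∈ Q i) := by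
  constructor
  · rintro ⟨x, hx, y, hy, h⟩
    refine ⟨x, y, by simpa using hx, by simpa using hy, fun i z hz => ?_⟩
    have h1 := congrArg (fun S => z ∈ S) (congrFun h i)
    simpa [restrict, mem_translate, hz, -one_div] using h1
  · rintro ⟨x, y, hx, hy, h⟩
    refine ⟨x, by simpa using hx, y, by simpa using hy, ?_⟩
    funext i
    ext z
    simp only [restrict, Set.mem_inter_iff, mem_translate, mem_closedBall_zero_iff, sub_neg_eq_add]
    exact and_congr_right fun hz => h i z hz

theorem Match.symm {ε : ℝ} {P Q : Family d m} (h : Match ε P Q) : Match ε Q P := by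
  obtain ⟨x, hx, y, hy, h⟩ := h
  exact ⟨y, hy, x, hx, h.symm⟩

theorem Match.mono {ε ε' : ℝ} {P Q : Family d m} (h : Match ε P Q) (h0 : 0 < ε) (hle : ε ≤ ε') :
    Match ε' P Q := by
  rw [match_iff] at h ⊢
  obtain ⟨x, y, hx, hy, h⟩ := h
  exact ⟨x, y, hx.trans hle, hy.trans hle,
    fun i z hz => h i z (hz.trans (one_div_le_one_div_of_le h0 hle))⟩

theorem bddBelow_hullDist (P Q : Family d m) :
    BddBelow (insert (√2)⁻¹ {ε : ℝ | 0 < ε ∧ Match ε P Q}) := by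
  refine ⟨0, ?_⟩
  rintro e (rfl | he)
  · positivity
  · exact he.1.le

theorem hullDist_nonneg (P Q : Family d m) : 0 ≤ hullDist P Q := by
  refine Real.sInf_nonneg ?_
  rintro e (rfl | he)
  · positivity
  · exact he.1.le

theorem hullDist_le_const (P Q : Family d m) : hullDist P Q ≤ (√2)⁻¹ :=
  csInf_le (bddBelow_hullDist P Q) (Set.mem_insert _ _)

theorem hullDist_le {ε : ℝ} {P Q : Family d m} (h0 : 0 < ε) (h : Match ε P Q) :
    hullDist P Q ≤ ε :=
  csInf_le (bddBelow_hullDist P Q) (Set.mem_insert_of_mem _ ⟨h0, h⟩)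

theorem match_of_hullDist_lt {ε : ℝ} {P Q : Family d m} (h : hullDist P Q < ε)
    (hε : ε ≤ (√2)⁻¹) : 0 < ε ∧ Match ε P Q := by
  obtain ⟨e, he, hlt⟩ := exists_lt_of_csInf_lt (Set.insert_nonempty _ _) h
  rcases he with rfl | he
  · exact absurd hlt (not_lt.2 hε)
  · exact ⟨he.1.trans hlt, he.2.mono he.1 hlt.le⟩

theorem inv_sqrt_two_sq : ((√2)⁻¹ : ℝ) ^ 2 = 1 / 2 := by
  rw [inv_pow, Real.sq_sqrt (by norm_num)]; norm_num

theorem aux_radius {a b : ℝ} (ha : 0 < a) (hb : 0 < b) (ha2 : a ≤ (√2)⁻¹) (hb2 : b ≤ (√2)⁻¹) :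
    1 / (a + b) + b ≤ 1 / a := by
  have hs := inv_sqrt_two_sq
  have h1 : a * a ≤ 1 / 2 := by rw [← hs, sq]; gcongr
  have h2 : a * b ≤ 1 / 2 := by rw [← hs, sq]; gcongr
  rw [div_add' _ _ _ (by positivity), div_le_div_iff₀ (by positivity) ha]
  nlinarith

theorem Match.triangle {a b : ℝ} {P Q S : Family d m} (ha : 0 < a) (hb : 0 < b)
    (ha2 : a ≤ (√2)⁻¹) (hb2 : b ≤ (√2)⁻¹) (h1 : Match a P Q) (h2 : Match b Q S) :
    Match (a + b) P S := by
  rw [match_iff] at *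
  obtain ⟨x, y, hx, hy, h1⟩ := h1
  obtain ⟨x', y', hx', hy', h2⟩ := h2
  refine ⟨x' + x, y + y', (norm_add_le _ _).trans (by linarith),
    (norm_add_le _ _).trans (by linarith), fun i z hz => ?_⟩
  have r1 := aux_radius ha hb ha2 hb2
  have r2 := aux_radius hb ha hb2 ha2
  rw [add_comm b a] at r2
  have e1 := h1 i (z + x') ((norm_add_le _ _).trans (by linarith))
  have e2 := h2 i (z + y) ((norm_add_le _ _).trans (by linarith))
  rw [add_assoc] at e1 e2
  rw [e1, ← add_assoc z y y', ← e2, add_assoc, add_comm x' y]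

theorem hullDist_self (P : Family d m) : hullDist P P = 0 := by
  refine le_antisymm (le_of_forall_pos_le_add fun e he => ?_) (hullDist_nonneg P P)
  rw [zero_add]
  exact hullDist_le he ⟨0, by simpa using he.le, 0, by simpa using he.le, rfl⟩

theorem hullDist_comm (P Q : Family d m) : hullDist P Q = hullDist Q P := by
  unfold hullDist
  congr 2
  ext e
  exact and_congr_right fun _ => ⟨Match.symm, Match.symm⟩

theorem hullDist_triangle (P Q S : Family d m) :
    hullDist P S ≤ hullDist P Q + hullDist Q S := by
  by_cases h1 : hullDist P Q < (√2)⁻¹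
  · by_cases h2 : hullDist Q S < (√2)⁻¹
    · refine le_of_forall_pos_le_add fun e he => ?_
      obtain ⟨a, ha, ha'⟩ := exists_between (lt_min h1 (lt_add_of_pos_right (hullDist P Q)
        (half_pos he)))
      obtain ⟨b, hb, hb'⟩ := exists_between (lt_min h2 (lt_add_of_pos_right (hullDist Q S)
        (half_pos he)))
      rw [lt_min_iff] at ha' hb'
      obtain ⟨a0, ma⟩ := match_of_hullDist_lt ha ha'.1.le
      obtain ⟨b0, mb⟩ := match_of_hullDist_lt hb hb'.1.le
      have := hullDist_le (add_pos a0 b0) (ma.triangle a0 b0 ha'.1.le hb'.1.le mb)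
      linarith [ha'.2, hb'.2]
    · linarith [hullDist_le_const P S, hullDist_nonneg P Q]
  · linarith [hullDist_le_const P S, hullDist_nonneg Q S]

theorem IsDelone.isClosed {S : Set (Space d)} (h : IsDelone S) : IsClosed S := by
  obtain ⟨D, rfl⟩ := h
  refine Metric.isClosed_of_pairwise_le_dist (ε := D.packingRadius) D.packingRadius_pos ?_
  intro x hx y hy hxy
  exact (D.packingRadius_lt_dist_of_mem_ne hx hy hxy).le

theorem subset_of_hullDist_eq_zero {P Q : Family d m} (hQ : ∀ i, IsClosed (Q i))
    (h : hullDist P Q = 0) (i : Fin m) : P i ⊆ Q i := by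
  intro p hp
  rw [← (hQ i).closure_eq, Metric.mem_closure_iff]
  intro e he
  set ε : ℝ := min (min (e / 3) (√2)⁻¹) (1 / (‖p‖ + 1)) with hε
  have h0 : 0 < ε := by positivity
  have hle3 : ε ≤ e / 3 := (min_le_left _ _).trans (min_le_left _ _)
  have hle2 : ε ≤ (√2)⁻¹ := (min_le_left _ _).trans (min_le_right _ _)
  have hle1 : ε ≤ 1 / (‖p‖ + 1) := min_le_right _ _
  have hone : ε ≤ 1 := by
    nlinarith [inv_sqrt_two_sq, inv_nonneg.2 (Real.sqrt_nonneg 2)]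
  have hrad : ‖p‖ + 1 ≤ 1 / ε := by
    rw [le_one_div (by positivity) h0]; exact hle1
  obtain ⟨x, y, hx, hy, hm⟩ := match_iff.1 (match_of_hullDist_lt (h ▸ h0) hle2).2
  have hz : ‖p - x‖ ≤ 1 / ε := (norm_sub_le _ _).trans (by linarith)
  refine ⟨p - x + y, (hm i _ hz).1 (by simpa using hp), ?_⟩
  rw [dist_eq_norm, show p - (p - x + y) = x - y by abel]
  exact (norm_sub_le _ _).trans_lt (by linarith)

instance : MetricSpace (DeloneMultiset d m) where
  dist Γ Δ := hullDist Γ.pts Δ.pts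
  dist_self Γ := hullDist_self Γ.pts
  dist_comm Γ Δ := hullDist_comm Γ.pts Δ.pts
  dist_triangle Γ Δ Θ := hullDist_triangle Γ.pts Δ.pts Θ.pts
  eq_of_dist_eq_zero {Γ Δ} h := by
    ext1
    funext i
    exact Set.Subset.antisymm
      (subset_of_hullDist_eq_zero (fun i => (Δ.isDelone_color i).isClosed) h i)
      (subset_of_hullDist_eq_zero (fun i => (Γ.isDelone_color i).isClosed)
        ((hullDist_comm _ _).trans h) i)

instance : MeasurableSpace (DeloneMultiset d m) := borel _

instance : BorelSpace (DeloneMultiset d m) := ⟨rfl⟩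

/-! ### The translation action and the hull -/

theorem IsDelone.vadd {S : Set (Space d)} (h : IsDelone S) (t : Space d) : IsDelone (t +ᵥ S) := by
  obtain ⟨D, rfl⟩ := h
  exact ⟨Delone.DeloneSet.mapIsometry (IsometryEquiv.constVAdd t) D, rfl⟩

theorem supp_translate (t : Space d) (P : Family d m) : supp (translate t P) = t +ᵥ supp P :=
  (Set.vadd_set_iUnion t P).symm

instance : AddAction (Space d) (DeloneMultiset d m) where
  vadd t Γ :=
    { pts := translate t Γ.pts
      isDelone_color := fun i => (Γ.isDelone_color i).vadd t
      isDelone_supp := supp_translate t Γ.pts ▸ Γ.isDelone_supp.vadd t }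
  zero_vadd Γ := DeloneMultiset.ext (funext fun i => zero_vadd (Space d) (Γ.pts i))
  add_vadd s t Γ := DeloneMultiset.ext (funext fun i => add_vadd s t (Γ.pts i))

theorem pts_vadd (t : Space d) (Γ : DeloneMultiset d m) : (t +ᵥ Γ).pts = translate t Γ.pts := rfl

instance : ContinuousConstVAdd (Space d) (DeloneMultiset d m) where
  continuous_const_vadd t := by
    rw [Metric.continuous_iff]
    intro Γ e he
    set ε : ℝ := min (min (e / 2) (√2)⁻¹) (1 / (2 / e + ‖t‖)) with hε
    have h0 : 0 < ε := by positivity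
    refine ⟨ε, h0, fun Δ hΔ => ?_⟩
    have hle3 : ε ≤ e / 2 := (min_le_left _ _).trans (min_le_left _ _)
    have hle2 : ε ≤ (√2)⁻¹ := (min_le_left _ _).trans (min_le_right _ _)
    have hle1 : ε ≤ 1 / (2 / e + ‖t‖) := min_le_right _ _
    have hrad : 2 / e + ‖t‖ ≤ 1 / ε := by
      rw [le_one_div (by positivity) h0]; exact hle1
    obtain ⟨x, y, hx, hy, hm⟩ := match_iff.1 (match_of_hullDist_lt hΔ hle2).2
    refine (hullDist_le (half_pos he) (match_iff.2
      ⟨x, y, hx.trans hle3, hy.trans hle3, fun i z hz => ?_⟩)).trans_lt (half_lt_self he)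
    rw [one_div_div] at hz
    rw [pts_vadd, pts_vadd, mem_translate, mem_translate, add_sub_right_comm, add_sub_right_comm]
    exact hm i (z - t) ((norm_sub_le _ _).trans (by linarith))

/-- The collection of all Delone multisets each of whose clusters is a translate of a
cluster of `Γ`. -/
def localClass (Γ : DeloneMultiset d m) : Set (DeloneMultiset d m) :=
  {Δ | ∀ P, IsCluster P Δ.pts → ∃ (t : Space d) (Q : Family d m),
    IsCluster Q Γ.pts ∧ P = translate t Q}

/-- The hull `X_Γ`: the closure of the translation orbit `{-h + Γ}` inside `localClass Γ`
(the closure in a subspace is the intersection of the subspace with the closure). -/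
def hull (Γ : DeloneMultiset d m) : Set (DeloneMultiset d m) :=
  closure (Set.range fun h : Space d => -h +ᵥ Γ) ∩ localClass Γ

theorem IsCluster.translate {P Q : Family d m} (h : IsCluster P Q) (t : Space d) :
    IsCluster (translate t P) (translate t Q) :=
  fun i => ⟨Set.vadd_set_mono (h i).1, (h i).2.vadd_set⟩

theorem translate_translate (s t : Space d) (P : Family d m) :
    translate s (translate t P) = translate (s + t) P :=
  funext fun i => (add_vadd s t (P i)).symm

theorem translate_zero (P : Family d m) : translate 0 P = P :=
  funext fun i => zero_vadd (Space d) (P i)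

theorem vadd_mem_hull {Γ Δ : DeloneMultiset d m} (t : Space d) (h : Δ ∈ hull Γ) :
    t +ᵥ Δ ∈ hull Γ := by
  refine ⟨?_, fun P hP => ?_⟩
  · refine map_mem_closure (f := fun Θ : DeloneMultiset d m => t +ᵥ Θ)
      (continuous_const_vadd t) h.1 ?_
    rintro _ ⟨g, rfl⟩
    exact ⟨g - t, by simp only [vadd_vadd]; congr 1; abel⟩
  · have hP' := hP.translate (-t)
    rw [pts_vadd, translate_translate, neg_add_cancel, translate_zero] at hP'
    obtain ⟨s, Q, hQ, e⟩ := h.2 _ hP'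
    refine ⟨t + s, Q, hQ, ?_⟩
    rw [← translate_translate, ← e, translate_translate, add_neg_cancel, translate_zero]

/-- The translation action of `ℝ^d` on the hull. -/
instance (Γ : DeloneMultiset d m) : AddAction (Space d) (hull Γ) where
  vadd t Δ := ⟨t +ᵥ Δ.1, vadd_mem_hull t Δ.2⟩
  zero_vadd Δ := Subtype.ext (zero_vadd (Space d) Δ.1)
  add_vadd s t Δ := Subtype.ext (add_vadd s t Δ.1)

/-- Unique ergodicity of `(X_Γ, ℝ^d)`: there is exactly one translation invariant Borel
probability measure on the hull. -/
def IsUniquelyErgodic (Γ : DeloneMultiset d m) : Prop :=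
  ∃! μ : Measure (hull Γ), IsProbabilityMeasure μ ∧ VAddInvariantMeasure (Space d) (hull Γ) μ

/-! ### Van Hove sequences and uniform cluster frequencies -/

/-- A van Hove sequence of bounded Lebesgue measurable sets. The volumes are required to be nonzero
so that the quotients make sense. `Metric.cthickening r S` is the set of points at distance at
most `r` from `S`. -/
structure IsVanHove (F : ℕ → Set (Space d)) : Prop where
  isBounded : ∀ n, Bornology.IsBounded (F n)
  measurable : ∀ n, NullMeasurableSet (F n) volume
  volume_ne_zero : ∀ n, volume (F n) ≠ 0
  tendsto : ∀ r : ℝ, 0 < r →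
    Tendsto (fun n => volume (Metric.cthickening r (frontier (F n))) / volume (F n)) atTop (𝓝 0)

/-- `L_P(A)`, the number of `x` with `x + P ⊆ A ∩ Γ`; this is a finite number when `A` is bounded
and `P` has at least one point. -/
def clusterCount (Γ : DeloneMultiset d m) (P : Family d m) (A : Set (Space d)) : ℕ :=
  {x : Space d | ∀ i, translate x P i ⊆ restrict A Γ.pts i}.ncard

/-- Uniform cluster frequencies relative to `F`: for every cluster of `Γ` (with at least one point)
the frequency exists, uniformly with respect to the position `x`. -/
def HasUCF (F : ℕ → Set (Space d)) (Γ : DeloneMultiset d m) : Prop :=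
  ∀ P : Family d m, IsCluster P Γ.pts → (∃ i, (P i).Nonempty) →
    ∃ freq : ℝ, TendstoUniformly
      (fun n (x : Space d) => (clusterCount Γ P (x +ᵥ F n) : ℝ) / (volume (F n)).toReal)
      (fun _ => freq) atTop

end DeloneHull

end

/-!
The proof compares cluster counts with averages of continuous functions on the hull. For a finite
pattern `P` and a compactly supported continuous `φ`, the pattern sum
`Δ ↦ ∑ φ x`, over all `x` with `x + P ⊆ Δ`, is continuous on the hull (`continuous_patternSum`).
Integrating it over the translates `-t + Δ`, `t ∈ F n`, counts every occurrence of `P` well inside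
`F n` with weight `∫ φ` and misses every occurrence well outside; since occurrences are uniformly
separated, those near the boundary are controlled by the van Hove condition
(`exists_abs_integral_patternSum_sub_le`). So the averages of pattern sums converge uniformly
exactly when the cluster frequencies do.

Finite local complexity makes the set of differences of support points locally finite
(`HasFLC.finite_diff`). Hence the hull is compact (`isCompact_hull`), and the product of two
pattern sums is a finite linear combination of pattern sums (`exists_patternSum_mul`), so that by
the Stone-Weierstrass theorem pattern sums and constants span a dense subspace of the continuous
functions on the hull (`dense_span_patternFuns`).

Limits of averages along a van Hove sequence are invariant probability measures
(`exists_invariant_measure`). If there is only one, then all averages converge uniformly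
(`eventually_abs_average_sub_lt`), which gives uniform cluster frequencies. Conversely, uniform
cluster frequencies make the averages of a pattern sum converge to a constant, uniformly on the
orbit of `Γ` and by density on the hull; this constant is the integral with respect to any invariant
probability measure (`integral_eq_of_average`), and density of the span gives uniqueness.
-/

open Set Filter Topology MeasureTheory
open scoped Pointwise

noncomputable section

namespace DeloneHull

variable {d m : ℕ}

/-! ### Sets of differences -/

theorem IsDelone.finite_inter_closedBall {S : Set (Space d)} (hS : IsDelone S) (x : Space d)
    (r : ℝ) : (Metric.closedBall x r ∩ S).Finite := by
  have hc := hS.isClosed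
  obtain ⟨E, rfl⟩ := hS
  refine Metric.finite_isBounded_inter_isClosed
    (isDiscrete_iff_discreteTopology.2 ?_) Metric.isBounded_closedBall hc
  exact .of_forall_le_dist E.packingRadius_pos fun p q hpq =>
    (E.packingRadius_lt_dist_of_mem_ne p.2 q.2 (Subtype.coe_ne_coe.2 hpq)).le

/-- Under finite local complexity the set of differences of support points is locally finite. This
is the form in which the hypothesis is used: the differences of points of a multiset in the hull
belong to the same set. -/
theorem HasFLC.finite_diff {Γ : DeloneMultiset d m} (h : HasFLC Γ) :
    ∀ r : ℝ, ((supp Γ.pts - supp Γ.pts) ∩ Metric.closedBall 0 r).Finite := by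
  intro r
  obtain ⟨Y, hY, -, hcov⟩ := h (max r 1) (by positivity)
  refine (hY.biUnion fun y _ => (Γ.isDelone_supp.finite_inter_closedBall y (max r 1)).image
    fun z => z - y).subset ?_
  rintro _ ⟨⟨p, hp, q, hq, rfl⟩, hr⟩
  obtain ⟨y, hy, e⟩ := hcov q hq
  obtain ⟨i, hi⟩ := mem_iUnion.1 hp
  have hp' : p ∈ restrict (Metric.closedBall q (max r 1)) Γ.pts i := by
    refine ⟨?_, hi⟩
    simp only [mem_closedBall_zero_iff] at hr
    rw [mem_closedBall_iff_norm]
    exact hr.trans (le_max_left _ _)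
  rw [e, mem_translate] at hp'
  refine mem_biUnion hy ⟨p - (q - y), ⟨hp'.1, mem_iUnion.2 ⟨i, hp'.2⟩⟩, ?_⟩
  change p - (q - y) - y = p - q
  abel

/-- A locally finite set has no nonzero elements of arbitrarily small norm. -/
theorem exists_packing {D : Set (Space d)} (hD : ∀ r : ℝ, (D ∩ Metric.closedBall 0 r).Finite) :
    ∃ δ : ℝ, 0 < δ ∧ ∀ v ∈ D, v ≠ 0 → δ < ‖v‖ := by
  have hf : ((D ∩ Metric.closedBall 0 1) \ {0}).Finite := (hD 1).subset sdiff_subset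
  obtain ⟨δ, h0, h⟩ : ∃ δ : ℝ, 0 < δ ∧ ∀ v ∈ (D ∩ Metric.closedBall 0 1) \ {0}, δ < ‖v‖ := by
    have : ∀ᶠ δ in 𝓝[>] (0 : ℝ), ∀ v ∈ (D ∩ Metric.closedBall 0 1) \ {0}, δ < ‖v‖ := by
      rw [eventually_all_finite hf]
      rintro v ⟨-, hv⟩
      exact mem_nhdsWithin_of_mem_nhds (Iio_mem_nhds (norm_pos_iff.2 hv))
    exact (Eventually.and (eventually_mem_nhdsWithin (a := (0 : ℝ)) (s := Ioi 0)) this).exists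
  refine ⟨min δ (1 / 2), by positivity, fun v hv hv0 => ?_⟩
  by_cases h1 : ‖v‖ ≤ 1
  · exact (min_le_left _ _).trans_lt (h v ⟨⟨hv, by simpa using h1⟩, hv0⟩)
  · exact (min_le_right _ _).trans_lt (by linarith)

/-- A relatively dense set whose differences lie in a locally finite set is Delone. -/
theorem isDelone_of_sub_mem {S D : Set (Space d)} (hD : ∀ r : ℝ, (D ∩ Metric.closedBall 0 r).Finite)
    (hS : ∀ p ∈ S, ∀ q ∈ S, p - q ∈ D) {R : ℝ} (hR : ∀ z, ∃ p ∈ S, dist z p ≤ R) :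
    IsDelone S := by
  obtain ⟨δ, h0, hδ⟩ := exists_packing hD
  have hR0 : 0 ≤ R := by obtain ⟨p, -, h⟩ := hR 0; exact dist_nonneg.trans h
  refine ⟨{ carrier := S
            packingRadius := δ.toNNReal
            packingRadius_pos := Real.toNNReal_pos.2 h0
            isSeparated_packingRadius := fun p hp q hq hpq => ?_
            coveringRadius := (R + 1).toNNReal
            coveringRadius_pos := Real.toNNReal_pos.2 (by positivity)
            isCover_coveringRadius := fun z _ => ?_ }, rfl⟩
  · change ENNReal.ofReal δ < edist p q
    have h := hδ _ (hS p hp q hq) (sub_ne_zero.2 hpq)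
    rw [edist_dist, dist_eq_norm]
    exact (ENNReal.ofReal_lt_ofReal_iff (h0.trans h)).2 h
  · obtain ⟨p, hp, h⟩ := hR z
    refine ⟨p, hp, ?_⟩
    change edist z p ≤ ENNReal.ofReal (R + 1)
    rw [edist_dist]
    exact ENNReal.ofReal_le_ofReal (h.trans (by linarith))

theorem IsDelone.exists_cover {S : Set (Space d)} (hS : IsDelone S) :
    ∃ R : ℝ, ∀ z, ∃ p ∈ S, dist z p ≤ R := by
  obtain ⟨E, rfl⟩ := hS
  exact ⟨E.coveringRadius, E.exists_dist_le_coveringRadius⟩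

/-! ### Compactness of the hull -/

/-- The Delone multisets all of whose differences of points lie in `D`, and whose color classes
and support are relatively dense with constant `R`. -/
def adapted (m : ℕ) (D : Set (Space d)) (R : ℝ) : Set (DeloneMultiset d m) :=
  {Δ | (∀ p ∈ supp Δ.pts, ∀ q ∈ supp Δ.pts, p - q ∈ D) ∧
    (∀ i z, ∃ p ∈ Δ.pts i, dist z p ≤ R) ∧ ∀ z, ∃ p ∈ supp Δ.pts, dist z p ≤ R}

/-- Recentered at a support point close to the origin, the multisets in `adapted m D R` only have
points in the locally finite set `D`, so on every ball an ultrafilter decides which points occur;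
the centers converge by compactness of a ball. -/
theorem isCompact_adapted {D : Set (Space d)} (hD : ∀ r : ℝ, (D ∩ Metric.closedBall 0 r).Finite)
    (R : ℝ) : IsCompact (adapted m D R) := by
  rw [isCompact_iff_ultrafilter_le_nhds]
  intro U hU
  have hU' : ∀ᶠ Δ in (U : Filter (DeloneMultiset d m)), Δ ∈ adapted m D R := le_principal_iff.1 hU
  have hb : ∀ Δ : DeloneMultiset d m, ∃ b, Δ ∈ adapted m D R → b ∈ supp Δ.pts ∧ ‖b‖ ≤ R := by
    intro Δ
    by_cases h : Δ ∈ adapted m D R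
    · obtain ⟨p, hp, hpR⟩ := h.2.2 0
      exact ⟨p, fun _ => ⟨hp, by simpa using hpR⟩⟩
    · exact ⟨0, fun h' => absurd h' h⟩
  choose b hb using hb
  obtain ⟨c, hc, hbc⟩ := isCompact_iff_ultrafilter_le_nhds.1
    (isCompact_closedBall (0 : Space d) R) (U.map b) (by
      rw [le_principal_iff]
      exact hU'.mono fun Δ h => by simpa using (hb Δ h).2)
  replace hbc : Tendsto b U (𝓝 c) := hbc
  have hcR : ‖c‖ ≤ R := by simpa using hc
  -- `T` is the limit of the recentered multisets `-b Δ + Δ`; the limit of the `Δ` is `c + T`.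
  set T : Family d m := fun i => {z | ∀ᶠ Δ in (U : Filter (DeloneMultiset d m)), z + b Δ ∈ Δ.pts i}
    with hT
  have agree : ∀ r : ℝ, ∀ᶠ Δ in (U : Filter (DeloneMultiset d m)), ∀ i, ∀ z : Space d, ‖z‖ ≤ r →
      (z + b Δ ∈ Δ.pts i ↔ z ∈ T i) := by
    intro r
    have h1 : ∀ᶠ Δ in (U : Filter (DeloneMultiset d m)), ∀ i, ∀ z ∈ D ∩ Metric.closedBall 0 r,
        (z + b Δ ∈ Δ.pts i ↔ z ∈ T i) := by
      rw [eventually_all]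
      intro i
      rw [eventually_all_finite (hD r)]
      intro z _
      by_cases hz : z ∈ T i
      · exact Eventually.mono hz fun Δ h => iff_of_true h hz
      · exact (Ultrafilter.eventually_not.2 hz).mono fun Δ h => iff_of_false h hz
    have key : ∀ Δ ∈ adapted m D R, ∀ i z, z + b Δ ∈ Δ.pts i → z ∈ D := fun Δ hΔ i z hz => by
      simpa using hΔ.1 _ (mem_iUnion.2 ⟨i, hz⟩) _ (hb Δ hΔ).1
    filter_upwards [h1, hU'] with Δ h1 hΔ i z hz
    by_cases hzD : z ∈ D
    · exact h1 i z ⟨hzD, by simpa using hz⟩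
    · refine iff_of_false (fun h => hzD (key Δ hΔ i z h)) fun h => hzD ?_
      obtain ⟨Δ', h', hΔ'⟩ := (Eventually.and h hU').exists
      exact key Δ' hΔ' i z h'
  have hmem : ∀ i z, z ∈ translate c T i ↔ z - c ∈ T i := fun i z => mem_translate
  have hdiff : ∀ p ∈ supp (translate c T), ∀ q ∈ supp (translate c T), p - q ∈ D := by
    intro p hp q hq
    obtain ⟨i, hp⟩ := mem_iUnion.1 hp
    obtain ⟨j, hq⟩ := mem_iUnion.1 hq
    obtain ⟨Δ, ⟨h1, h2⟩, h3⟩ := ((Eventually.and ((hmem _ _).1 hp) ((hmem _ _).1 hq)).and hU').exists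
    simpa using h3.1 _ (mem_iUnion.2 ⟨i, h1⟩) _ (mem_iUnion.2 ⟨j, h2⟩)
  have transfer : ∀ (z : Space d), ∃ Δ ∈ adapted m D R, ∀ i p, p ∈ Δ.pts i →
      dist (z - c + b Δ) p ≤ R → p - b Δ + c ∈ translate c T i ∧ dist z (p - b Δ + c) ≤ R := by
    intro z
    obtain ⟨Δ, h1, hΔ⟩ := ((agree (‖z - c‖ + R)).and hU').exists
    refine ⟨Δ, hΔ, fun i p hp hd => ?_⟩
    have e : dist z (p - b Δ + c) = dist (z - c + b Δ) p := by
      rw [dist_eq_norm, dist_eq_norm]; congr 1; abel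
    refine ⟨?_, e.trans_le hd⟩
    rw [hmem, add_sub_cancel_right, ← h1 i, sub_add_cancel]
    · exact hp
    · rw [dist_eq_norm] at hd
      calc ‖p - b Δ‖ = ‖(z - c) - (z - c + b Δ - p)‖ := by congr 1; abel
        _ ≤ _ := (norm_sub_le _ _).trans (by linarith)
  have hcol : ∀ i z, ∃ p ∈ translate c T i, dist z p ≤ R := by
    intro i z
    obtain ⟨Δ, hΔ, h⟩ := transfer z
    obtain ⟨p, hp, hd⟩ := hΔ.2.1 i (z - c + b Δ)
    exact ⟨_, h i p hp hd⟩
  have hsup : ∀ z, ∃ p ∈ supp (translate c T), dist z p ≤ R := by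
    intro z
    obtain ⟨Δ, hΔ, h⟩ := transfer z
    obtain ⟨p, hp, hd⟩ := hΔ.2.2 (z - c + b Δ)
    obtain ⟨i, hp⟩ := mem_iUnion.1 hp
    exact ⟨_, mem_iUnion.2 ⟨i, (h i p hp hd).1⟩, (h i p hp hd).2⟩
  let Θ : DeloneMultiset d m :=
    { pts := translate c T
      isDelone_color := fun i => isDelone_of_sub_mem hD (fun p hp q hq =>
        hdiff p (mem_iUnion.2 ⟨i, hp⟩) q (mem_iUnion.2 ⟨i, hq⟩)) (hcol i)
      isDelone_supp := isDelone_of_sub_mem hD hdiff hsup }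
  refine ⟨Θ, ⟨hdiff, hcol, hsup⟩, ?_⟩
  rw [Metric.nhds_basis_ball.ge_iff]
  intro e he
  have hclose : ∀ᶠ Δ in (U : Filter (DeloneMultiset d m)), dist (b Δ) c ≤ e / 2 :=
    (Metric.tendsto_nhds.1 hbc _ (half_pos he)).mono fun _ h => h.le
  filter_upwards [agree (1 / (e / 2) + R), hclose] with Δ h1 h2
  rw [dist_eq_norm] at h2
  refine (hullDist_le (half_pos he) (match_iff.2 ⟨b Δ - c, 0, h2, by simpa using (half_pos he).le,
    fun i z hz => ?_⟩)).trans_lt (half_lt_self he)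
  rw [add_zero, show Θ.pts = translate c T from rfl, hmem, ← h1 i (z - c), sub_add_eq_add_sub,
    add_sub_assoc]
  exact (norm_sub_le _ _).trans (by linarith)

/-- On every ball, a multiset in the orbit closure agrees with a translate of `Γ`. -/
theorem exists_agree_of_mem_closure {Γ Δ : DeloneMultiset d m}
    (h : Δ ∈ closure (range fun h : Space d => -h +ᵥ Γ)) (r : ℝ) :
    ∃ t : Space d, ∀ i, ∀ z : Space d, ‖z‖ ≤ r → (z ∈ Δ.pts i ↔ z + t ∈ Γ.pts i) := by
  set ε : ℝ := min (√2)⁻¹ (1 / (|r| + 1)) with hε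
  have h0 : 0 < ε := by positivity
  have hle : ε ≤ (√2)⁻¹ := min_le_left _ _
  have hone : ε ≤ 1 := by nlinarith [inv_sqrt_two_sq, inv_nonneg.2 (Real.sqrt_nonneg 2)]
  have hrad : |r| + 1 ≤ 1 / ε := by
    rw [le_one_div (by positivity) h0]; exact min_le_right _ _
  obtain ⟨_, ⟨s, rfl⟩, hs⟩ := Metric.mem_closure_iff.1 h ε h0
  obtain ⟨x, y, hx, hy, hm⟩ := match_iff.1 (match_of_hullDist_lt hs hle).2
  refine ⟨-x + y + s, fun i z hz => ?_⟩
  have := hm i (z - x) ((norm_sub_le _ _).trans (by linarith [le_abs_self r]))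
  rw [sub_add_cancel, pts_vadd, mem_translate] at this
  rw [this]
  congr! 1
  abel

/-- The orbit closure is contained in `localClass Γ`, so the hull is the whole orbit closure. -/
theorem hull_eq_closure (Γ : DeloneMultiset d m) :
    hull Γ = closure (range fun h : Space d => -h +ᵥ Γ) := by
  refine inter_eq_left.2 fun Δ hΔ P hP => ?_
  obtain ⟨r, hr⟩ : ∃ r : ℝ, ∀ i, ∀ z ∈ P i, ‖z‖ ≤ r := by
    obtain ⟨r, hr⟩ := (finite_iUnion fun i => (hP i).2).isBounded.exists_norm_le
    exact ⟨r, fun i z hz => hr z (mem_iUnion.2 ⟨i, hz⟩)⟩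
  obtain ⟨t, ht⟩ := exists_agree_of_mem_closure hΔ r
  refine ⟨-t, translate t P, fun i => ⟨?_, (hP i).2.vadd_set⟩, ?_⟩
  · intro z hz
    rw [mem_translate] at hz
    simpa using (ht i _ (hr i _ hz)).1 ((hP i).1 hz)
  · rw [translate_translate, neg_add_cancel, translate_zero]

theorem exists_hull_subset_adapted {Γ : DeloneMultiset d m} (hΓ : HasFLC Γ) :
    ∃ R : ℝ, hull Γ ⊆ adapted m (supp Γ.pts - supp Γ.pts) R := by
  choose R hR using fun i => (Γ.isDelone_color i).exists_cover
  obtain ⟨R₀, hR₀⟩ := Γ.isDelone_supp.exists_cover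
  obtain ⟨B, hB⟩ := (finite_range R).bddAbove
  refine ⟨max B R₀, ?_⟩
  rw [hull_eq_closure]
  refine closure_minimal ?_ (isCompact_adapted hΓ.finite_diff _).isClosed
  rintro _ ⟨h, rfl⟩
  have hp : ∀ i z, z ∈ (-h +ᵥ Γ).pts i ↔ z + h ∈ Γ.pts i := fun i z => by
    rw [pts_vadd, mem_translate, sub_neg_eq_add]
  have hs : ∀ z, z ∈ supp (-h +ᵥ Γ).pts ↔ z + h ∈ supp Γ.pts := fun z => by
    simp only [supp, mem_iUnion, hp]
  refine ⟨fun p hp q hq => ?_, fun i z => ?_, fun z => ?_⟩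
  · rw [hs] at hp hq
    exact ⟨_, hp, _, hq, by simp⟩
  · obtain ⟨p, hp', hd⟩ := hR i (z + h)
    refine ⟨p - h, by rwa [hp, sub_add_cancel], ?_⟩
    rw [dist_eq_norm, sub_sub_eq_add_sub, ← dist_eq_norm]
    exact hd.trans ((hB ⟨i, rfl⟩).trans (le_max_left _ _))
  · obtain ⟨p, hp', hd⟩ := hR₀ (z + h)
    refine ⟨p - h, by rwa [hs, sub_add_cancel], ?_⟩
    rw [dist_eq_norm, sub_sub_eq_add_sub, ← dist_eq_norm]
    exact hd.trans (le_max_right _ _)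

theorem isCompact_hull {Γ : DeloneMultiset d m} (hΓ : HasFLC Γ) : IsCompact (hull Γ) := by
  obtain ⟨R, hR⟩ := exists_hull_subset_adapted hΓ
  refine (isCompact_adapted hΓ.finite_diff R).of_isClosed_subset ?_ hR
  rw [hull_eq_closure]
  exact isClosed_closure

theorem mem_hull_self (Γ : DeloneMultiset d m) : Γ ∈ hull Γ := by
  rw [hull_eq_closure]
  exact subset_closure ⟨0, by simp⟩

theorem dist_vadd_le (s t : Space d) (Γ : DeloneMultiset d m) :
    dist (s +ᵥ Γ) (t +ᵥ Γ) ≤ ‖s - t‖ := by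
  refine le_of_forall_gt_imp_ge_of_dense fun e he => ?_
  have h0 : 0 < e := (norm_nonneg _).trans_lt he
  refine hullDist_le h0 (match_iff.2 ⟨s - t, 0, he.le, by simpa using h0.le, fun i z _ => ?_⟩)
  rw [pts_vadd, pts_vadd, mem_translate, mem_translate]
  congr! 1
  abel

instance : ContinuousVAdd (Space d) (DeloneMultiset d m) where
  continuous_vadd := by
    rw [continuous_iff_continuousAt]
    rintro ⟨t, Γ⟩
    rw [ContinuousAt, tendsto_iff_dist_tendsto_zero]
    have h1 : Tendsto (fun p : Space d × DeloneMultiset d m => ‖p.1 - t‖ + dist (t +ᵥ p.2) (t +ᵥ Γ))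
        (𝓝 (t, Γ)) (𝓝 0) := by
      have : Continuous fun p : Space d × DeloneMultiset d m =>
          ‖p.1 - t‖ + dist (t +ᵥ p.2) (t +ᵥ Γ) := by fun_prop
      simpa using this.tendsto (t, Γ)
    refine squeeze_zero (fun _ => dist_nonneg) (fun p => ?_) h1
    exact (dist_triangle _ (t +ᵥ p.2) _).trans (by gcongr; exact dist_vadd_le _ _ _)

instance (Γ : DeloneMultiset d m) : ContinuousVAdd (Space d) (hull Γ) where
  continuous_vadd := by
    refine Continuous.subtype_mk (f := fun p : Space d × hull Γ => p.1 +ᵥ p.2.1) ?_ _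
    fun_prop

/-! ### Occurrences of patterns and pattern sums -/

/-- The set of all `x` with `x + P ⊆ Q`. -/
def occ (P Q : Family d m) : Set (Space d) := {x | ∀ i, translate x P i ⊆ Q i}

theorem mem_occ {P Q : Family d m} {x : Space d} :
    x ∈ occ P Q ↔ ∀ i, ∀ p ∈ P i, p + x ∈ Q i := by
  refine forall_congr' fun i => ⟨fun h p hp => h (mem_translate.2 (by simpa using hp)),
    fun h z hz => ?_⟩
  simpa using h _ (mem_translate.1 hz)

theorem mem_occ_translate_right {P Q : Family d m} {t x : Space d} :
    x ∈ occ P (translate t Q) ↔ x - t ∈ occ P Q := by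
  simp only [mem_occ, mem_translate, add_sub_assoc]

theorem mem_occ_sup_translate {P Q S : Family d m} {z x : Space d} :
    x ∈ occ (P ⊔ translate z Q) S ↔ x ∈ occ P S ∧ x + z ∈ occ Q S := by
  simp only [mem_occ, Pi.sup_apply, sup_eq_union, mem_union, or_imp, forall_and, mem_translate]
  refine and_congr_right fun _ => ⟨fun h i q hq => ?_, fun h i p hp => ?_⟩
  · have := h i (q + z) (by simpa using hq)
    rwa [add_assoc, add_comm z x] at this
  · have := h i _ hp
    rwa [show p - z + (x + z) = p + x by abel] at this

theorem sub_mem_of_mem_occ {D : Set (Space d)} {P Q : Family d m} (hne : ∃ i, (P i).Nonempty)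
    (hQ : ∀ p ∈ supp Q, ∀ q ∈ supp Q, p - q ∈ D) {x y : Space d} (hx : x ∈ occ P Q)
    (hy : y ∈ occ P Q) : x - y ∈ D := by
  obtain ⟨i, p, hp⟩ := hne
  simpa using hQ _ (mem_iUnion.2 ⟨i, mem_occ.1 hx i p hp⟩) _
    (mem_iUnion.2 ⟨i, mem_occ.1 hy i p hp⟩)

theorem finite_occ_inter_closedBall {D : Set (Space d)}
    (hD : ∀ r : ℝ, (D ∩ Metric.closedBall 0 r).Finite) {P Q : Family d m}
    (hne : ∃ i, (P i).Nonempty) (hQ : ∀ p ∈ supp Q, ∀ q ∈ supp Q, p - q ∈ D) (r : ℝ) :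
    (occ P Q ∩ Metric.closedBall 0 r).Finite := by
  rcases (occ P Q ∩ Metric.closedBall 0 r).eq_empty_or_nonempty with h | ⟨y, hy, hyr⟩
  · rw [h]; exact finite_empty
  · refine ((hD (r + r)).image fun v => v + y).subset ?_
    rintro x ⟨hx, hxr⟩
    refine ⟨x - y, ⟨sub_mem_of_mem_occ hne hQ hx hy, ?_⟩, sub_add_cancel x y⟩
    rw [mem_closedBall_zero_iff] at *
    exact (norm_sub_le _ _).trans (add_le_add hxr hyr)

/-- The sum of `φ` over all occurrences of the pattern `P` in `Q`. In use, `φ` has compact support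
and only finitely many terms are nonzero, so the default value of `finsum` plays no role. -/
def patternSum (P : Family d m) (φ : Space d → ℝ) (Q : Family d m) : ℝ := ∑ᶠ x ∈ occ P Q, φ x

/-- A pattern sum is computed by any finite set `S + v` of occurrences that contains all those at
which `φ` does not vanish. The shift `v` lets one set `S` serve several translated multisets. -/
theorem patternSum_eq_sum {P Q : Family d m} {φ : Space d → ℝ} (v : Space d)
    {S : Finset (Space d)} (hS : ∀ u ∈ S, u + v ∈ occ P Q)
    (hcap : ∀ u, u + v ∈ occ P Q → φ (u + v) ≠ 0 → u ∈ S) :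
    patternSum P φ Q = ∑ u ∈ S, φ (u + v) := by
  classical
  rw [patternSum, finsum_mem_eq_sum_of_inter_support_eq φ (t := S.image (· + v)),
    Finset.sum_image fun a _ b _ h => add_right_cancel h]
  ext x
  simp only [mem_inter_iff, Function.mem_support, Finset.coe_image, mem_image, Finset.mem_coe]
  refine and_congr_left fun hx => ⟨fun h => ⟨x - v, hcap _ ?_ ?_, sub_add_cancel x v⟩, ?_⟩
  · rwa [sub_add_cancel]
  · rwa [sub_add_cancel]
  · rintro ⟨u, hu, rfl⟩
    exact hS u hu

theorem exists_norm_le_of_hasCompactSupport {φ : Space d → ℝ} (h : HasCompactSupport φ) :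
    ∃ r : ℝ, 0 < r ∧ ∀ x, φ x ≠ 0 → ‖x‖ ≤ r := by
  obtain ⟨r, hr⟩ := h.isBounded.exists_norm_le
  exact ⟨max r 1, by positivity, fun x hx => (hr x (subset_tsupport φ hx)).trans (le_max_left _ _)⟩

theorem exists_norm_le_of_finite {P : Family d m} (hP : ∀ i, (P i).Finite) :
    ∃ r : ℝ, 0 < r ∧ ∀ i, ∀ p ∈ P i, ‖p‖ ≤ r := by
  obtain ⟨r, hr⟩ := (finite_iUnion hP).isBounded.exists_norm_le
  exact ⟨max r 1, by positivity, fun i p hp =>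
    (hr p (mem_iUnion.2 ⟨i, hp⟩)).trans (le_max_left _ _)⟩

theorem hull_diff_mem {Γ : DeloneMultiset d m} (hΓ : HasFLC Γ) {Δ : DeloneMultiset d m}
    (hΔ : Δ ∈ hull Γ) : ∀ p ∈ supp Δ.pts, ∀ q ∈ supp Δ.pts, p - q ∈ supp Γ.pts - supp Γ.pts := by
  obtain ⟨R, hR⟩ := exists_hull_subset_adapted hΓ
  exact (hR hΔ).1

/-- Two nearby multisets agree on a large ball up to a small shift `x - y`, so their occurrences
near the support of `φ` correspond to each other under that shift. -/
theorem continuous_patternSum {Γ : DeloneMultiset d m} (hΓ : HasFLC Γ) {P : Family d m}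
    (hP : ∀ i, (P i).Finite) (hne : ∃ i, (P i).Nonempty) {φ : Space d → ℝ} (hφ : Continuous φ)
    (hφc : HasCompactSupport φ) : Continuous fun Δ : hull Γ => patternSum P φ Δ.1.pts := by
  obtain ⟨r, hr0, hr⟩ := exists_norm_le_of_hasCompactSupport hφc
  obtain ⟨ρ, hρ0, hρ⟩ := exists_norm_le_of_finite hP
  rw [Metric.continuous_iff]
  intro Δ e he
  have hfin := finite_occ_inter_closedBall hΓ.finite_diff hne (hull_diff_mem hΓ Δ.2) (r + 1)
  set S := hfin.toFinset with hS
  have hmemS : ∀ s, s ∈ S ↔ s ∈ occ P Δ.1.pts ∧ ‖s‖ ≤ r + 1 := fun s => by simp [hS]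
  obtain ⟨η, hη0, hη⟩ := Metric.uniformContinuous_iff.1
    (hφc.uniformContinuous_of_continuous hφ) (e / (S.card + 1)) (by positivity)
  set ε : ℝ := min (min (η / 3) (1 / 2)) (min (√2)⁻¹ (1 / (r + 2 + ρ))) with hε
  have h0 : 0 < ε := by positivity
  have h1 : ε ≤ η / 3 := (min_le_left _ _).trans (min_le_left _ _)
  have h2 : ε ≤ 1 / 2 := (min_le_left _ _).trans (min_le_right _ _)
  have h3 : ε ≤ (√2)⁻¹ := (min_le_right _ _).trans (min_le_left _ _)
  have h4 : r + 2 + ρ ≤ 1 / ε := by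
    rw [le_one_div (by positivity) h0]
    exact (min_le_right _ _).trans (min_le_right _ _)
  refine ⟨ε, h0, fun Δ' hd => ?_⟩
  obtain ⟨x, y, hx, hy, hm⟩ := match_iff.1 (match_of_hullDist_lt hd h3).2
  have hocc : ∀ s : Space d, ‖s‖ ≤ r + 1 + 1 / 2 →
      (s + (x - y) ∈ occ P Δ'.1.pts ↔ s ∈ occ P Δ.1.pts) := by
    intro s hs
    rw [mem_occ, mem_occ]
    refine forall_congr' fun i => forall₂_congr fun p hp => ?_
    have := hm i (p + s - y) ((norm_sub_le _ _).trans (by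
      linarith [norm_add_le p s, hρ i p hp]))
    rwa [sub_add_cancel, show p + s - y + x = p + (s + (x - y)) by abel] at this
  have hxy : ‖x - y‖ ≤ 2 * ε := (norm_sub_le _ _).trans (by linarith)
  have e1 : patternSum P φ Δ.1.pts = ∑ s ∈ S, φ (s + 0) := by
    refine patternSum_eq_sum 0 (fun u hu => ?_) fun u hu hu' => ?_
    · rw [add_zero]; exact ((hmemS u).1 hu).1
    · rw [add_zero] at hu hu'
      exact (hmemS u).2 ⟨hu, (hr _ hu').trans (by linarith)⟩
  have e2 : patternSum P φ Δ'.1.pts = ∑ s ∈ S, φ (s + (x - y)) := by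
    refine patternSum_eq_sum (x - y) (fun u hu => ?_) fun u hu hu' => ?_
    · obtain ⟨hu1, hu2⟩ := (hmemS u).1 hu
      exact (hocc u (by linarith)).2 hu1
    · have hun : ‖u‖ ≤ r + 1 := by
        have := norm_sub_le (u + (x - y)) (x - y)
        rw [add_sub_cancel_right] at this
        linarith [hr _ hu']
      exact (hmemS u).2 ⟨(hocc u (by linarith)).1 hu, hun⟩
  rw [e1, e2, Real.dist_eq, ← Finset.sum_sub_distrib]
  calc |∑ s ∈ S, (φ (s + (x - y)) - φ (s + 0))|
      ≤ ∑ s ∈ S, |φ (s + (x - y)) - φ (s + 0)| := Finset.abs_sum_le_sum_abs _ _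
    _ ≤ ∑ _s ∈ S, e / (S.card + 1) := by
        refine Finset.sum_le_sum fun s _ => ?_
        rw [← Real.dist_eq]
        refine (hη ?_).le
        rw [dist_eq_norm, add_sub_add_left_eq_sub, sub_zero]
        linarith
    _ < e := by
        have hc : (0 : ℝ) < S.card + 1 := by positivity
        rw [Finset.sum_const, nsmul_eq_mul, ← mul_div_assoc, div_lt_iff₀ hc]
        linarith

/-- The product of two pattern sums is a finite sum of pattern sums: by finite local complexity,
only finitely many relative positions of the two patterns contribute, and `P` together with the
pattern `Q` in relative position `z` is again a pattern. -/
theorem exists_patternSum_mul {Γ : DeloneMultiset d m} (hΓ : HasFLC Γ) {P Q : Family d m}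
    (hPne : ∃ i, (P i).Nonempty) (hQne : ∃ i, (Q i).Nonempty) {φ ψ : Space d → ℝ}
    (hφc : HasCompactSupport φ) (hψc : HasCompactSupport ψ) :
    ∃ Z : Finset (Space d), ∀ Δ ∈ hull Γ, patternSum P φ Δ.pts * patternSum Q ψ Δ.pts =
      ∑ z ∈ Z, patternSum (P ⊔ translate z Q) (fun x => φ x * ψ (x + z)) Δ.pts := by
  classical
  obtain ⟨r, hr0, hr⟩ := exists_norm_le_of_hasCompactSupport hφc
  obtain ⟨r', hr0', hr'⟩ := exists_norm_le_of_hasCompactSupport hψc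
  obtain ⟨i, p, hp⟩ := hPne
  obtain ⟨j, q, hq⟩ := hQne
  set Z := ((hΓ.finite_diff (r + r' + ‖p‖ + ‖q‖)).image fun v => v + p - q).toFinset with hZ
  refine ⟨Z, fun Δ hΔ => ?_⟩
  have hdiff := hull_diff_mem hΓ hΔ
  have hmemZ : ∀ x ∈ occ P Δ.pts, ∀ y ∈ occ Q Δ.pts, φ x ≠ 0 → ψ y ≠ 0 → y - x ∈ Z := by
    intro x hx y hy hx' hy'
    rw [hZ, Finite.mem_toFinset]
    refine ⟨(q + y) - (p + x), ⟨hdiff _ (mem_iUnion.2 ⟨j, mem_occ.1 hy j q hq⟩) _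
      (mem_iUnion.2 ⟨i, mem_occ.1 hx i p hp⟩), ?_⟩, by abel_nf⟩
    rw [mem_closedBall_zero_iff]
    linarith [norm_sub_le (q + y) (p + x), norm_add_le q y, norm_add_le p x, hr x hx', hr' y hy']
  have hfin := finite_occ_inter_closedBall hΓ.finite_diff ⟨i, p, hp⟩ hdiff r
  set S := hfin.toFinset with hS
  have hmemS : ∀ s, s ∈ S ↔ s ∈ occ P Δ.pts ∧ ‖s‖ ≤ r := fun s => by simp [hS]
  have e1 : patternSum P φ Δ.pts = ∑ s ∈ S, φ (s + 0) := by
    refine patternSum_eq_sum 0 (fun u hu => ?_) fun u hu hu' => ?_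
    · rw [add_zero]; exact ((hmemS u).1 hu).1
    · rw [add_zero] at hu hu'
      exact (hmemS u).2 ⟨hu, hr _ hu'⟩
  have e2 : ∀ z, patternSum (P ⊔ translate z Q) (fun x => φ x * ψ (x + z)) Δ.pts =
      ∑ s ∈ S, if s + z ∈ occ Q Δ.pts then φ s * ψ (s + z) else 0 := by
    intro z
    rw [← Finset.sum_filter]
    have := patternSum_eq_sum (P := P ⊔ translate z Q) (Q := Δ.pts)
      (φ := fun x => φ x * ψ (x + z)) 0 (S := S.filter fun s => s + z ∈ occ Q Δ.pts) ?_ ?_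
    · simpa using this
    · intro u hu
      rw [Finset.mem_filter, hmemS] at hu
      rw [add_zero, mem_occ_sup_translate]
      exact ⟨hu.1.1, hu.2⟩
    · intro u hu hu'
      rw [add_zero] at hu hu'
      rw [mem_occ_sup_translate] at hu
      rw [Finset.mem_filter, hmemS]
      exact ⟨⟨hu.1, hr _ (left_ne_zero_of_mul hu')⟩, hu.2⟩
  simp_rw [e2]
  rw [e1, Finset.sum_mul, Finset.sum_comm]
  refine Finset.sum_congr rfl fun s hs => ?_
  rw [add_zero]
  by_cases hs0 : φ s = 0
  · simp [hs0]
  rw [← Finset.sum_filter, ← Finset.mul_sum]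
  congr 1
  rw [patternSum_eq_sum (S := Z.filter fun z => s + z ∈ occ Q Δ.pts) s]
  · simp_rw [add_comm]
  · intro u hu
    rw [add_comm]
    exact (Finset.mem_filter.1 hu).2
  · intro u hu hu'
    refine Finset.mem_filter.2 ⟨?_, by rwa [add_comm]⟩
    simpa using hmemZ s ((hmemS s).1 hs).1 _ hu hs0 hu'

/-- If `p` is a point of color `i` of `Δ` but not of `Δ'`, then the one-point pattern of color `i`
and a bump at `p` tell the two multisets apart. -/
theorem exists_patternSum_ne {Γ : DeloneMultiset d m} (hΓ : HasFLC Γ)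
    {Δ Δ' : DeloneMultiset d m} (hΔ : Δ ∈ hull Γ) {i : Fin m} {p : Space d}
    (hp : p ∈ Δ.pts i) (hp' : p ∉ Δ'.pts i) :
    ∃ (P : Family d m) (φ : Space d → ℝ), (∀ j, (P j).Finite) ∧ (∃ j, (P j).Nonempty) ∧
      Continuous φ ∧ HasCompactSupport φ ∧
      patternSum P φ Δ.pts ≠ patternSum P φ Δ'.pts := by
  classical
  obtain ⟨η, hη0, hη⟩ := Metric.isOpen_iff.1 (Δ'.isDelone_color i).isClosed.isOpen_compl p hp'
  set P : Family d m := fun j => if j = i then {0} else ∅ with hPdef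
  set φ : Space d → ℝ := fun x => max 0 (η - dist x p) with hφdef
  have hne : ∃ j, (P j).Nonempty := ⟨i, by simp [hPdef]⟩
  have hφ0 : ∀ x, 0 ≤ φ x := fun x => le_max_left _ _
  have hφball : ∀ x, φ x ≠ 0 → x ∈ Metric.ball p η := by
    intro x hx
    by_contra h
    exact hx (max_eq_left (by rw [Metric.mem_ball, not_lt] at h; linarith))
  have hφc : HasCompactSupport φ :=
    HasCompactSupport.intro (isCompact_closedBall p η) fun x hx => by
      by_contra h
      exact hx (Metric.ball_subset_closedBall (hφball x h))
  have hocc : ∀ Q : Family d m, ∀ x, x ∈ occ P Q ↔ x ∈ Q i := by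
    intro Q x
    rw [mem_occ]
    refine ⟨fun h => by simpa using h i 0 (by simp [hPdef]), fun h j q hq => ?_⟩
    by_cases hj : j = i
    · subst hj
      have : q = 0 := by simpa [hPdef] using hq
      simpa [this] using h
    · simp [hPdef, hj] at hq
  refine ⟨P, φ, fun j => ?_, hne, by fun_prop, hφc, ?_⟩
  · by_cases hj : j = i <;> simp [hPdef, hj]
  have h0 : patternSum P φ Δ'.pts = 0 := by
    rw [patternSum_eq_sum (S := ∅) 0] <;> simp only [Finset.sum_empty, Finset.notMem_empty,
      false_imp_iff, implies_true, add_zero]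
    intro u hu hu'
    exact hη (hφball u hu') ((hocc _ _).1 hu)
  obtain ⟨r, hr0, hr⟩ := exists_norm_le_of_hasCompactSupport hφc
  have hfin := finite_occ_inter_closedBall hΓ.finite_diff hne (hull_diff_mem hΓ hΔ) r
  have hpos : φ p ≤ patternSum P φ Δ.pts := by
    have hφp : φ p ≠ 0 := by simp [hφdef, hη0.le, hη0.ne']
    rw [patternSum_eq_sum (S := hfin.toFinset) 0]
    · refine le_of_eq_of_le (by rw [add_zero]) (Finset.single_le_sum
        (f := fun u => φ (u + 0)) (fun u _ => hφ0 _) (a := p) ?_)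
      simpa using ⟨(hocc _ _).2 hp, hr p hφp⟩
    · intro u hu
      simp only [Finite.mem_toFinset] at hu
      simpa using hu.1
    · intro u hu hu'
      rw [add_zero] at hu hu'
      simpa using ⟨hu, hr u hu'⟩
  have : φ p = η := by simp [hφdef, hη0.le]
  rw [h0]
  exact (hη0.trans_le (this.ge.trans hpos)).ne'

/-- The pattern sum as a continuous function on the hull. -/
def patternFun {Γ : DeloneMultiset d m} (hΓ : HasFLC Γ) {P : Family d m}
    (hP : ∀ i, (P i).Finite) (hne : ∃ i, (P i).Nonempty) {φ : Space d → ℝ} (hφ : Continuous φ)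
    (hφc : HasCompactSupport φ) : C(hull Γ, ℝ) :=
  ⟨_, continuous_patternSum hΓ hP hne hφ hφc⟩

/-- The continuous functions on the hull which are pattern sums. -/
def patternFuns (Γ : DeloneMultiset d m) : Set C(hull Γ, ℝ) :=
  {f | ∃ (P : Family d m) (φ : Space d → ℝ), (∀ j, (P j).Finite) ∧ (∃ j, (P j).Nonempty) ∧
      Continuous φ ∧ HasCompactSupport φ ∧ ∀ Δ, f Δ = patternSum P φ Δ.1.pts}

/-- Linear combinations of constants and pattern sums are dense, by the Stone-Weierstrass
theorem. -/
theorem dense_span_patternFuns {Γ : DeloneMultiset d m} (hΓ : HasFLC Γ) :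
    Dense (Submodule.span ℝ (insert 1 (patternFuns Γ)) : Set C(hull Γ, ℝ)) := by
  have : CompactSpace (hull Γ) := isCompact_iff_compactSpace.1 (isCompact_hull hΓ)
  set M := Submodule.span ℝ (insert 1 (patternFuns Γ)) with hM
  have hone : (1 : C(hull Γ, ℝ)) ∈ M := Submodule.subset_span (mem_insert _ _)
  -- By `exists_patternSum_mul` the span is closed under multiplication.
  have hmul : M * M ≤ M := by
    rw [hM, Submodule.span_mul_span, Submodule.span_le]
    rintro _ ⟨f, hf, g, hg, rfl⟩
    rcases hf with rfl | hf
    · simpa using Submodule.subset_span hg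
    rcases hg with rfl | hg
    · simpa using Submodule.subset_span (mem_insert_of_mem _ hf)
    obtain ⟨P, φ, hP, hPne, hφ, hφc, hf⟩ := hf
    obtain ⟨Q, ψ, hQ, hQne, hψ, hψc, hg⟩ := hg
    obtain ⟨Z, hZ⟩ := exists_patternSum_mul hΓ hPne hQne hφc hψc
    have hfam : ∀ z i, ((P ⊔ translate z Q) i).Finite := fun z i =>
      (hP i).union ((hQ i).vadd_set)
    have hfamne : ∀ z, ∃ i, ((P ⊔ translate z Q) i).Nonempty := fun z =>
      hPne.imp fun i h => h.mono subset_union_left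
    have hcont : ∀ z, Continuous fun x => φ x * ψ (x + z) := fun z => by fun_prop
    have hsupp : ∀ z, HasCompactSupport fun x => φ x * ψ (x + z) := fun z => hφc.mul_right
    have e : f * g = ∑ z ∈ Z, patternFun hΓ (hfam z) (hfamne z) (hcont z) (hsupp z) := by
      ext Δ
      simp only [ContinuousMap.mul_apply, ContinuousMap.coe_sum, Finset.sum_apply, hf, hg]
      exact hZ Δ.1 Δ.2
    change f * g ∈ _
    rw [e]
    exact Submodule.sum_mem _ fun z _ => Submodule.subset_span (mem_insert_of_mem _
      ⟨_, _, hfam z, hfamne z, hcont z, hsupp z, fun Δ => rfl⟩)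
  set A : Subalgebra ℝ C(hull Γ, ℝ) := M.toSubalgebra hone fun f g hf hg =>
    hmul (Submodule.mul_mem_mul hf hg) with hA
  have hsep : A.SeparatesPoints := by
    intro Δ Δ' hne
    obtain ⟨i, hi⟩ : ∃ i, Δ.1.pts i ≠ Δ'.1.pts i := by
      by_contra! h
      exact hne (Subtype.ext (DeloneMultiset.ext (funext h)))
    have hmem : ∀ Δ Δ' : hull Γ, ∀ p ∈ Δ.1.pts i, p ∉ Δ'.1.pts i → ∃ f ∈ A, f Δ ≠ f Δ' := by
      intro Δ Δ' p hp hp'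
      obtain ⟨P, φ, hP, hPne, hφ, hφc, hφne⟩ := exists_patternSum_ne hΓ Δ.2 hp hp'
      exact ⟨patternFun hΓ hP hPne hφ hφc, Submodule.subset_span (mem_insert_of_mem _
        ⟨_, _, hP, hPne, hφ, hφc, fun Δ => rfl⟩), hφne⟩
    rcases not_and_or.1 (mt (fun h => Subset.antisymm h.1 h.2) hi) with h | h
    · obtain ⟨p, hp, hp'⟩ := not_subset.1 h
      obtain ⟨f, hf, hff⟩ := hmem Δ Δ' p hp hp'
      exact ⟨f, ⟨f, hf, rfl⟩, hff⟩
    · obtain ⟨p, hp, hp'⟩ := not_subset.1 h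
      obtain ⟨f, hf, hff⟩ := hmem Δ' Δ p hp hp'
      exact ⟨f, ⟨f, hf, rfl⟩, hff.symm⟩
  have htop := ContinuousMap.subalgebra_topologicalClosure_eq_top_of_separatesPoints A hsep
  intro f
  have : f ∈ A.topologicalClosure := htop ▸ Algebra.mem_top
  exact this

/-! ### Counting clusters and integrating pattern sums -/

/-- Balls are connected, so a ball that stays away from the boundary of `F` does not cross it. -/
theorem closedBall_subset_or_disjoint_of_notMem_cthickening {F : Set (Space d)} {x : Space d}
    {r : ℝ} (hx : x ∉ Metric.cthickening r (frontier F)) :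
    Metric.closedBall x r ⊆ F ∨ Disjoint (Metric.closedBall x r) F := by
  have hpre : IsPreconnected (Metric.closedBall x r) := (convex_closedBall x r).isPreconnected
  have hcov : Metric.closedBall x r ⊆ interior F ∪ (closure F)ᶜ := by
    intro y hy
    by_contra h
    rw [mem_union, not_or, notMem_compl_iff] at h
    exact hx (Metric.mem_cthickening_of_dist_le x y r _ ⟨h.2, h.1⟩ (Metric.mem_closedBall'.1 hy))
  refine (IsPreconnected.subset_or_subset isOpen_interior isClosed_closure.isOpen_compl
    (disjoint_compl_right.mono_left interior_subset_closure) hcov hpre).imp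
    (fun h => h.trans interior_subset) fun h => ?_
  exact (subset_compl_iff_disjoint_right.1 h).mono_right subset_closure

/-- A packing estimate: disjoint balls around the points of `S` fit into a neighborhood of `G`. -/
theorem card_mul_volume_ball_le {S : Finset (Space d)} {δ ρ : ℝ} (hδ : 0 < δ) (hρ : 0 ≤ ρ)
    (hsep : ∀ x ∈ S, ∀ y ∈ S, x ≠ y → δ < ‖x - y‖) {G : Set (Space d)}
    (hS : ∀ x ∈ S, x ∈ Metric.cthickening ρ G) :
    (S.card : ENNReal) * volume (Metric.ball (0 : Space d) (δ / 2)) ≤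
      volume (Metric.cthickening (δ + ρ) G) := by
  have hdisj : (S : Set (Space d)).PairwiseDisjoint fun x => Metric.ball x (δ / 2) := by
    intro x hx y hy hxy
    refine Metric.ball_disjoint_ball ?_
    rw [add_halves, dist_eq_norm]
    exact (hsep x hx y hy hxy).le
  calc (S.card : ENNReal) * volume (Metric.ball (0 : Space d) (δ / 2))
      = ∑ x ∈ S, volume (Metric.ball x (δ / 2)) := by
        simp_rw [Measure.addHaar_ball_center]
        rw [Finset.sum_const, nsmul_eq_mul]
    _ = volume (⋃ x ∈ S, Metric.ball x (δ / 2)) :=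
        (measure_biUnion_finset hdisj fun x _ => measurableSet_ball).symm
    _ ≤ _ := by
        refine measure_mono (iUnion₂_subset fun x hx => ?_)
        refine Subset.trans ?_ (Metric.cthickening_cthickening_subset hδ.le hρ G)
        refine Subset.trans ?_ (Metric.closedBall_subset_cthickening (hS x hx) δ)
        exact (Metric.ball_subset_ball (by linarith)).trans Metric.ball_subset_closedBall

/-- The integral of a pattern sum over the translates by `-t`, `t ∈ F`, agrees with the number of
occurrences of the pattern in `F`, up to the contribution of those occurrences that are close to
the boundary of `F`. -/
theorem exists_abs_integral_patternSum_sub_le {D : Set (Space d)}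
    (hD : ∀ r : ℝ, (D ∩ Metric.closedBall 0 r).Finite) {P : Family d m}
    (hP : ∀ i, (P i).Finite) (hne : ∃ i, (P i).Nonempty) {φ : Space d → ℝ} (hφ : Continuous φ)
    (hφc : HasCompactSupport φ) :
    ∃ C ρ : ℝ, 0 < ρ ∧ ∀ Δ : DeloneMultiset d m,
      (∀ p ∈ supp Δ.pts, ∀ q ∈ supp Δ.pts, p - q ∈ D) → ∀ F : Set (Space d),
      Bornology.IsBounded F → NullMeasurableSet F volume →
      |(∫ t in F, patternSum P φ (-t +ᵥ Δ).pts) - (∫ x, φ x) * clusterCount Δ P F| ≤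
        C * (volume (Metric.cthickening ρ (frontier F))).toReal := by
  classical
  obtain ⟨r₁, hr₁0, hr₁⟩ := exists_norm_le_of_hasCompactSupport hφc
  obtain ⟨r₂, hr₂0, hr₂⟩ := exists_norm_le_of_finite hP
  obtain ⟨δ, hδ0, hδ⟩ := exists_packing hD
  set r := max r₁ r₂ with hrdef
  have hr0 : 0 < r := lt_max_of_lt_left hr₁0
  have hφr : ∀ x, φ x ≠ 0 → ‖x‖ ≤ r := fun x hx => (hr₁ x hx).trans (le_max_left _ _)
  have hPr : ∀ i, ∀ p ∈ P i, ‖p‖ ≤ r := fun i p hp => (hr₂ i p hp).trans (le_max_right _ _)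
  have hint : Integrable φ := hφ.integrable_of_hasCompactSupport hφc
  set I : ℝ := ∫ x, |φ x| with hI
  have hI0 : 0 ≤ I := integral_nonneg fun _ => abs_nonneg _
  set β : ENNReal := volume (Metric.ball (0 : Space d) (δ / 2)) with hβ
  have hβ0 : 0 < β.toReal :=
    ENNReal.toReal_pos (Metric.measure_ball_pos _ _ (half_pos hδ0)).ne' measure_ball_lt_top.ne
  refine ⟨2 * I / β.toReal, δ + r, by positivity, fun Δ hΔ F hF hFm => ?_⟩
  obtain ⟨M, hM⟩ := hF.exists_norm_le
  have hfin := finite_occ_inter_closedBall hD hne hΔ (M + r)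
  set S := hfin.toFinset with hS
  have hmemS : ∀ s, s ∈ S ↔ s ∈ occ P Δ.pts ∧ ‖s‖ ≤ M + r := fun s => by simp [hS]
  set w : Space d → ℝ := fun x => ∫ t in F, φ (x - t) with hw
  have hint' : ∀ x, Integrable fun t => φ (x - t) := fun x => hint.comp_sub_left x
  have e1 : (∫ t in F, patternSum P φ (-t +ᵥ Δ).pts) = ∑ x ∈ S, w x := by
    rw [hw, ← integral_finsetSum _ fun x _ => (hint' x).restrict]
    refine integral_congr_ae ((ae_restrict_iff'₀ hFm).2 (Eventually.of_forall fun t ht => ?_))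
    change patternSum P φ (translate (-t) Δ.pts) = _
    simp_rw [sub_eq_add_neg]
    refine patternSum_eq_sum (-t) (fun u hu => ?_) fun u hu hu' => ?_
    · rw [mem_occ_translate_right, add_sub_cancel_right]
      exact ((hmemS u).1 hu).1
    · rw [mem_occ_translate_right, add_sub_cancel_right] at hu
      refine (hmemS u).2 ⟨hu, ?_⟩
      have := norm_add_le (u + -t) t
      rw [neg_add_cancel_right] at this
      linarith [hφr _ hu', hM t ht]
  have e2 : clusterCount Δ P F = (S.filter fun x => ∀ i, ∀ p ∈ P i, p + x ∈ F).card := by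
    rw [clusterCount, ← Set.ncard_coe_finset]
    congr 1
    ext x
    rw [Finset.mem_coe, Finset.mem_filter, hmemS]
    have h1 : (∀ i, translate x P i ⊆ restrict F Δ.pts i) ↔
        (∀ i, ∀ p ∈ P i, p + x ∈ F) ∧ x ∈ occ P Δ.pts := by
      have := mem_occ (P := P) (Q := restrict F Δ.pts) (x := x)
      rw [mem_occ]
      refine this.trans ?_
      simp only [restrict, mem_inter_iff, ← forall_and]
    rw [mem_ofPred_eq, h1]
    refine ⟨fun h => ⟨⟨h.2, ?_⟩, h.1⟩, fun h => ⟨h.2, h.1.1⟩⟩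
    obtain ⟨i, p, hp⟩ := hne
    have := norm_sub_le (p + x) p
    rw [add_sub_cancel_left] at this
    linarith [hM _ (h.1 i p hp), hPr i p hp]
  set c := ∫ x, φ x with hc
  set N := S.filter fun x => x ∈ Metric.cthickening r (frontier F) with hN
  have hw_le : ∀ x, |w x| ≤ I := fun x => by
    calc |w x| ≤ ∫ t in F, |φ (x - t)| := abs_integral_le_integral_abs
      _ ≤ ∫ t, |φ (x - t)| :=
        setIntegral_le_integral (hint' x).abs (Eventually.of_forall fun _ => abs_nonneg _)
      _ = I := integral_sub_left_eq_self (fun t => |φ t|) volume x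
  have hc_le : |c| ≤ I := abs_integral_le_integral_abs
  -- Only occurrences close to the boundary of `F` contribute to the error.
  have hterm : ∀ x ∈ S, |w x - if ∀ i, ∀ p ∈ P i, p + x ∈ F then c else 0| ≤
      if x ∈ Metric.cthickening r (frontier F) then 2 * I else 0 := by
    intro x _
    have hball : ∀ t, φ (x - t) ≠ 0 → t ∈ Metric.closedBall x r := fun t ht => by
      rw [Metric.mem_closedBall', dist_eq_norm]
      exact hφr _ ht
    have hballP : ∀ i, ∀ p ∈ P i, p + x ∈ Metric.closedBall x r := fun i p hp => by
      simpa using hPr i p hp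
    split_ifs with h1 h2 h2
    · linarith [abs_sub (w x) c, hw_le x]
    · rcases closedBall_subset_or_disjoint_of_notMem_cthickening h2 with h | h
      · have : w x = c := by
          rw [hw]
          simp only
          rw [setIntegral_eq_integral_of_forall_compl_eq_zero,
            integral_sub_left_eq_self φ volume x]
          intro t ht
          by_contra h0
          exact ht (h (hball t h0))
        simp [this]
      · obtain ⟨i, p, hp⟩ := hne
        exact absurd (h1 i p hp) (disjoint_left.1 h (hballP i p hp))
    · rw [sub_zero]; linarith [hw_le x]
    · rcases closedBall_subset_or_disjoint_of_notMem_cthickening h2 with h | h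
      · exact absurd (fun i p hp => h (hballP i p hp)) h1
      · have : w x = 0 := setIntegral_eq_zero_of_forall_eq_zero fun t ht => by
          by_contra h0
          exact disjoint_left.1 h (hball t h0) ht
        simp [this]
  have hcard : (N.card : ℝ) * β.toReal ≤
      (volume (Metric.cthickening (δ + r) (frontier F))).toReal := by
    have h1 := card_mul_volume_ball_le (S := N) (G := frontier F) hδ0 hr0.le
      (fun x hx y hy hxy => hδ _ (sub_mem_of_mem_occ hne hΔ
        ((hmemS x).1 (Finset.mem_filter.1 hx).1).1 ((hmemS y).1 (Finset.mem_filter.1 hy).1).1)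
        (sub_ne_zero.2 hxy)) fun x hx => (Finset.mem_filter.1 hx).2
    have hfinite : volume (Metric.cthickening (δ + r) (frontier F)) ≠ ⊤ :=
      (hF.closure.subset frontier_subset_closure).cthickening.measure_lt_top.ne
    simpa using ENNReal.toReal_mono hfinite h1
  calc |(∫ t in F, patternSum P φ (-t +ᵥ Δ).pts) - c * clusterCount Δ P F|
      = |∑ x ∈ S, (w x - if ∀ i, ∀ p ∈ P i, p + x ∈ F then c else 0)| := by
        rw [e1, e2, Finset.sum_sub_distrib, ← Finset.sum_filter, Finset.sum_const, nsmul_eq_mul,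
          mul_comm c]
    _ ≤ ∑ x ∈ S, if x ∈ Metric.cthickening r (frontier F) then 2 * I else 0 :=
        (Finset.abs_sum_le_sum_abs _ _).trans (Finset.sum_le_sum hterm)
    _ = N.card * (2 * I) := by
        rw [← Finset.sum_filter, Finset.sum_const, nsmul_eq_mul]
    _ = 2 * I / β.toReal * (N.card * β.toReal) := by field_simp
    _ ≤ _ := by gcongr

/-! ### Averages along a van Hove sequence -/

theorem IsVanHove.volume_ne_top {F : ℕ → Set (Space d)} (hF : IsVanHove F) (n : ℕ) :
    volume (F n) ≠ ⊤ := (hF.isBounded n).measure_lt_top.ne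

theorem IsVanHove.volume_toReal_pos {F : ℕ → Set (Space d)} (hF : IsVanHove F) (n : ℕ) :
    0 < (volume (F n)).toReal := ENNReal.toReal_pos (hF.volume_ne_zero n) (hF.volume_ne_top n)

theorem IsVanHove.tendsto_toReal {F : ℕ → Set (Space d)} (hF : IsVanHove F) {r : ℝ} (hr : 0 < r) :
    Tendsto (fun n => (volume (Metric.cthickening r (frontier (F n)))).toReal /
      (volume (F n)).toReal) atTop (𝓝 0) := by
  simpa [Function.comp_def] using (ENNReal.tendsto_toReal ENNReal.zero_ne_top).comp (hF.tendsto r hr)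

/-- A translation by `s` changes the integral over `F` only by a boundary term. -/
theorem abs_setIntegral_sub_translate_le {F : Set (Space d)} (hF : Bornology.IsBounded F)
    (hFm : NullMeasurableSet F volume) {g : Space d → ℝ} (hg : Continuous g) {C : ℝ}
    (hC : ∀ x, |g x| ≤ C) (s : Space d) :
    |(∫ t in F, g (t + s)) - ∫ t in F, g t| ≤
      C * (volume (Metric.cthickening ‖s‖ (frontier F))).toReal := by
  have hFtop : volume F ≠ ⊤ := hF.measure_lt_top.ne
  have hgF : ∀ u : Space d, IntegrableOn (fun t => g (t + u)) F := fun u =>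
    Measure.integrableOn_of_bounded (M := C) hFtop
      (hg.comp (continuous_add_const u)).aestronglyMeasurable
      (Eventually.of_forall fun t => hC _)
  have hi : ∀ u : Space d, Integrable (F.indicator fun t => g (t + u)) := fun u =>
    (hgF u).integrable_indicator₀ hFm
  have e1 : ∫ t in F, g (t + s) = ∫ t, F.indicator (fun t => g (t + s)) (t - s) := by
    rw [integral_sub_right_eq_self (F.indicator fun t => g (t + s)) s, integral_indicator₀ hFm]
  have e2 : ∫ t in F, g t = ∫ t, F.indicator g t := (integral_indicator₀ hFm).symm
  have hi1 := (hi s).comp_sub_right s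
  have hi2 : Integrable (F.indicator g) := by simpa using hi 0
  set K := Metric.cthickening ‖s‖ (frontier F) with hK
  have hKm : MeasurableSet K := Metric.isClosed_cthickening.measurableSet
  have hKtop : volume K ≠ ⊤ :=
    (hF.closure.subset frontier_subset_closure).cthickening.measure_lt_top.ne
  rw [e1, e2, ← integral_sub hi1 hi2]
  have hb : ∀ t, ‖F.indicator (fun t => g (t + s)) (t - s) - F.indicator g t‖ ≤
      K.indicator (fun _ => C) t := by
    intro t
    have hC0 : 0 ≤ C := (abs_nonneg _).trans (hC 0)
    by_cases ht : t ∈ K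
    · rw [indicator_of_mem ht]
      by_cases h1 : t - s ∈ F <;> by_cases h2 : t ∈ F <;> simp [h1, h2, hC0]
      · exact hC t
      · exact hC t
    · rw [indicator_of_notMem ht]
      have h := closedBall_subset_or_disjoint_of_notMem_cthickening ht
      have h1 : t - s ∈ Metric.closedBall t ‖s‖ := by simp
      have h2 : t ∈ Metric.closedBall t ‖s‖ := by simp
      rcases h with h | h
      · simp [h h1, h h2]
      · simp [disjoint_left.1 h h1, disjoint_left.1 h h2]
  calc |∫ t, (F.indicator (fun t => g (t + s)) (t - s) - F.indicator g t)|
      ≤ ∫ t, K.indicator (fun _ => C) t :=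
        norm_integral_le_of_norm_le ((integrable_indicator_iff hKm).2
          (integrableOn_const hKtop)) (Eventually.of_forall hb)
    _ = C * (volume K).toReal := by
        rw [integral_indicator hKm, setIntegral_const, smul_eq_mul, mul_comm]; rfl

section Averages

variable {X : Type*} [TopologicalSpace X] [AddAction (Space d) X]

/-- The average of `f (-t + x)` over all `t ∈ F`. -/
def average (F : Set (Space d)) (f : X → ℝ) (x : X) : ℝ :=
  (∫ t in F, f (-t +ᵥ x)) / (volume F).toReal

variable [ContinuousVAdd (Space d) X]

/-- Every limit of averages along a van Hove sequence is given by an invariant measure. -/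
theorem exists_invariant_measure [CompactSpace X] [T2Space X] [HasOuterApproxClosed X]
    [MeasurableSpace X] [BorelSpace X]
    {F : ℕ → Set (Space d)} (hF : IsVanHove F) (x : ℕ → X) (U : Ultrafilter ℕ)
    (hU : (U : Filter ℕ) ≤ atTop) :
    ∃ μ : Measure X, (IsProbabilityMeasure μ ∧ VAddInvariantMeasure (Space d) X μ) ∧
      ∀ f : C(X, ℝ), Tendsto (fun n => average (F n) f (x n)) U (𝓝 (∫ y, f y ∂μ)) := by
  have hmeas : ∀ n, Measurable fun t : Space d => -t +ᵥ x n := fun n => by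
    have : Continuous fun t : Space d => -t +ᵥ x n := by fun_prop
    exact this.measurable
  have hprob : ∀ n, IsProbabilityMeasure (ProbabilityTheory.cond volume (F n)) := fun n =>
    ProbabilityTheory.cond_isProbabilityMeasure_of_finite (hF.volume_ne_zero n) (hF.volume_ne_top n)
  let ν : ℕ → ProbabilityMeasure X := fun n =>
    ⟨(ProbabilityTheory.cond volume (F n)).map fun t : Space d => -t +ᵥ x n,
      Measure.isProbabilityMeasure_map (hmeas n).aemeasurable⟩
  have hν : ∀ n (f : C(X, ℝ)), ∫ y, f y ∂(ν n : Measure X) = average (F n) f (x n) := by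
    intro n f
    change ∫ y, f y ∂((ProbabilityTheory.cond volume (F n)).map fun t : Space d => -t +ᵥ x n) = _
    rw [integral_map (hmeas n).aemeasurable f.continuous.aestronglyMeasurable,
      ProbabilityTheory.cond, integral_smul_measure, average, ENNReal.toReal_inv, smul_eq_mul,
      div_eq_inv_mul]
  -- The space of probability measures on a compact space is compact.
  obtain ⟨μ, -, hμ⟩ := isCompact_iff_ultrafilter_le_nhds.1
    (isCompact_univ (X := ProbabilityMeasure X)) (U.map ν) (by simp)
  replace hμ : Tendsto ν U (𝓝 μ) := hμ
  have hlim : ∀ f : C(X, ℝ), Tendsto (fun n => average (F n) f (x n)) U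
      (𝓝 (∫ y, f y ∂(μ : Measure X))) := by
    intro f
    have := ProbabilityMeasure.tendsto_iff_forall_integral_tendsto.1 hμ
      (BoundedContinuousFunction.mkOfCompact f)
    simpa [hν] using this
  have hinv : ∀ (s : Space d) (f : C(X, ℝ)),
      ∫ y, f (s +ᵥ y) ∂(μ : Measure X) = ∫ y, f y ∂(μ : Measure X) := by
    intro s f
    have hl1 := hlim (f.comp ⟨fun y => s +ᵥ y, by fun_prop⟩)
    refine tendsto_nhds_unique hl1 ?_
    have hl2 : Tendsto (fun n => average (F n) (f.comp ⟨fun y => s +ᵥ y, by fun_prop⟩) (x n) -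
        average (F n) f (x n)) U (𝓝 0) := by
      refine squeeze_zero_norm (fun n => ?_) (a := fun n => ‖f‖ *
        ((volume (Metric.cthickening (‖s‖ + 1) (frontier (F n)))).toReal /
          (volume (F n)).toReal)) ?_
      · have h := abs_setIntegral_sub_translate_le (hF.isBounded n) (hF.measurable n)
          (g := fun t => f (-t +ᵥ x n)) (by fun_prop) (C := ‖f‖) (fun t => f.norm_coe_le_norm _)
          (-s)
        have e : ∀ t, f (-(t + -s) +ᵥ x n) = f (s +ᵥ -t +ᵥ x n) := fun t => by
          rw [vadd_vadd, neg_add_rev, neg_neg]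
        simp_rw [e] at h
        rw [average, average, ← sub_div, norm_div, Real.norm_eq_abs, Real.norm_eq_abs,
          abs_of_pos (hF.volume_toReal_pos n), ← mul_div_assoc]
        refine div_le_div_of_nonneg_right (h.trans ?_) (hF.volume_toReal_pos n).le
        refine mul_le_mul_of_nonneg_left ?_ (norm_nonneg _)
        refine ENNReal.toReal_mono ((hF.isBounded n).closure.subset
          frontier_subset_closure).cthickening.measure_lt_top.ne
          (measure_mono (Metric.cthickening_mono ?_ _))
        rw [norm_neg]; linarith
      · simpa using ((hF.tendsto_toReal (r := ‖s‖ + 1) (by positivity)).mono_left hU).const_mul ‖f‖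
    simpa using hl2.add (hlim f)
  refine ⟨μ, ⟨inferInstance, ⟨fun s A hA => ?_⟩⟩, hlim⟩
  have hs : Measurable fun y : X => s +ᵥ y := by
    have : Continuous fun y : X => s +ᵥ y := by fun_prop
    exact this.measurable
  have : (μ : Measure X).map (fun y => s +ᵥ y) = μ := by
    have := Measure.isProbabilityMeasure_map (μ := (μ : Measure X)) hs.aemeasurable
    refine ext_of_forall_integral_eq_of_IsFiniteMeasure fun f => ?_
    rw [integral_map hs.aemeasurable f.continuous.aestronglyMeasurable]
    exact hinv s f.toContinuousMap
  rw [← Measure.map_apply hs hA, this]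

theorem continuous_average [CompactSpace X] [FirstCountableTopology X] {F : Set (Space d)}
    (hF : volume F ≠ ⊤) (f : C(X, ℝ)) : Continuous (average F f) := by
  refine Continuous.div_const ?_ _
  have : IsFiniteMeasure (volume.restrict F) := ⟨by simpa [lt_top_iff_ne_top] using hF⟩
  refine continuous_of_dominated (bound := fun _ => ‖f‖) (fun x => ?_) (fun x => ?_)
    (integrable_const _) ?_
  · exact Continuous.aestronglyMeasurable (by fun_prop)
  · exact Eventually.of_forall fun t => f.norm_coe_le_norm _
  · exact Eventually.of_forall fun t => by fun_prop

/-- Averaging does not change the integral with respect to an invariant measure. -/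
theorem integral_average [CompactSpace X] [SecondCountableTopology X]
    [MeasurableSpace X] [BorelSpace X] {F : Set (Space d)} (hF0 : volume F ≠ 0)
    (hF : volume F ≠ ⊤) (μ : Measure X) [IsProbabilityMeasure μ]
    [VAddInvariantMeasure (Space d) X μ] (f : C(X, ℝ)) :
    ∫ x, average F f x ∂μ = ∫ x, f x ∂μ := by
  have : IsFiniteMeasure (volume.restrict F) := ⟨by simpa [lt_top_iff_ne_top] using hF⟩
  have hpos : 0 < (volume F).toReal := ENNReal.toReal_pos hF0 hF
  have hinv : ∀ t : Space d, ∫ x, f (-t +ᵥ x) ∂μ = ∫ x, f x ∂μ := by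
    intro t
    have hs : Measurable fun y : X => -t +ᵥ y := by
      have : Continuous fun y : X => -t +ᵥ y := by fun_prop
      exact this.measurable
    have hmp : μ.map (fun y => -t +ᵥ y) = μ := by
      ext A hA
      rw [Measure.map_apply hs hA]
      exact VAddInvariantMeasure.measure_preimage_vadd (-t) hA
    conv_rhs => rw [← hmp]
    rw [integral_map hs.aemeasurable f.continuous.aestronglyMeasurable]
  unfold average
  rw [integral_div, integral_integral_swap]
  · simp_rw [hinv]
    rw [setIntegral_const, smul_eq_mul, div_eq_iff hpos.ne', mul_comm]
    rfl
  · refine Integrable.of_bound (C := ‖f‖) ?_ (Eventually.of_forall fun p => f.norm_coe_le_norm _)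
    have : Continuous (Function.uncurry fun (x : X) (t : Space d) => f (-t +ᵥ x)) := by
      unfold Function.uncurry
      fun_prop
    exact this.aestronglyMeasurable

end Averages

/-! ### Averages and invariant measures -/

section UniqueErgodicity

variable {X : Type*} [TopologicalSpace X] [AddAction (Space d) X] [ContinuousVAdd (Space d) X]
  [CompactSpace X] [MeasurableSpace X] [BorelSpace X]

/-- If there is only one invariant probability measure, then the averages converge uniformly:
otherwise a limit of bad averages would be a second invariant measure. -/
theorem eventually_abs_average_sub_lt [T2Space X] [HasOuterApproxClosed X]
    {F : ℕ → Set (Space d)} (hF : IsVanHove F) {μ : Measure X}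
    (hμ : ∀ ν : Measure X, IsProbabilityMeasure ν ∧ VAddInvariantMeasure (Space d) X ν → ν = μ)
    (f : C(X, ℝ)) {ε : ℝ} (hε : 0 < ε) :
    ∀ᶠ n in atTop, ∀ x, |average (F n) f x - ∫ y, f y ∂μ| < ε := by
  by_contra hcon
  rw [not_eventually] at hcon
  -- `x n` is a bad point whenever there is one; `U` is an ultrafilter on the bad `n`.
  have hex : ∀ n, ∃ x : X, (¬∀ x, |average (F n) f x - ∫ y, f y ∂μ| < ε) →
      ε ≤ |average (F n) f x - ∫ y, f y ∂μ| := by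
    intro n
    by_cases h : ∀ x, |average (F n) f x - ∫ y, f y ∂μ| < ε
    · obtain ⟨n', hn'⟩ := hcon.exists
      push Not at hn'
      exact ⟨hn'.choose, fun h' => absurd h h'⟩
    · have h' := h
      push Not at h'
      exact ⟨h'.choose, fun _ => h'.choose_spec⟩
  choose x hx using hex
  have hne : (atTop ⊓ 𝓟 {n | ¬∀ x, |average (F n) f x - ∫ y, f y ∂μ| < ε}).NeBot :=
    frequently_mem_iff_neBot.1 hcon
  set U := Ultrafilter.of (atTop ⊓ 𝓟 {n | ¬∀ x, |average (F n) f x - ∫ y, f y ∂μ| < ε})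
  have hU : (U : Filter ℕ) ≤ _ := Ultrafilter.of_le _
  obtain ⟨ν, hν, hlim⟩ := exists_invariant_measure hF x U (hU.trans inf_le_left)
  obtain rfl := hμ ν hν
  have hbad : ∀ᶠ n in (U : Filter ℕ), ¬∀ x, |average (F n) f x - ∫ y, f y ∂ν| < ε :=
    le_principal_iff.1 (hU.trans inf_le_right)
  have hgood := Metric.tendsto_nhds.1 (hlim f) ε hε
  obtain ⟨n, h1, h2⟩ := (hbad.and hgood).exists
  exact not_lt.2 (hx n h1) h2

/-- If the averages of `f` converge uniformly to a constant, this constant is the integral of `f`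
with respect to every invariant probability measure. -/
theorem integral_eq_of_average [SecondCountableTopology X] {F : ℕ → Set (Space d)}
    (hF : IsVanHove F) (f : C(X, ℝ)) {a : ℝ}
    (h : ∀ ε : ℝ, 0 < ε → ∀ᶠ n in atTop, ∀ x, |average (F n) f x - a| ≤ ε)
    (μ : Measure X) [IsProbabilityMeasure μ] [VAddInvariantMeasure (Space d) X μ] :
    ∫ x, f x ∂μ = a := by
  refine eq_of_abs_sub_le_all fun ε hε => ?_
  obtain ⟨n, hn⟩ := (h ε hε).exists
  have hint : Integrable (average (F n) f) μ :=
    (continuous_average (hF.volume_ne_top n) f).integrable_of_hasCompactSupport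
      (HasCompactSupport.of_compactSpace _)
  rw [← integral_average (hF.volume_ne_zero n) (hF.volume_ne_top n) μ f]
  have e : ∫ x, average (F n) f x ∂μ - a = ∫ x, (average (F n) f x - a) ∂μ := by
    rw [integral_sub hint (integrable_const a)]; simp
  rw [e, ← Real.norm_eq_abs]
  simpa using norm_integral_le_of_norm_le_const (μ := μ)
    (f := fun x => average (F n) f x - a) (Eventually.of_forall hn)

/-- Two probability measures agree if they agree on a set of continuous functions which together
with the constants spans a dense subspace. -/
theorem measure_eq_of_dense_span [HasOuterApproxClosed X] {S : Set C(X, ℝ)}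
    (hS : Dense (Submodule.span ℝ (insert 1 S) : Set C(X, ℝ))) {μ ν : Measure X}
    [IsProbabilityMeasure μ] [IsProbabilityMeasure ν]
    (h : ∀ f ∈ S, ∫ x, f x ∂μ = ∫ x, f x ∂ν) : μ = ν := by
  have hint : ∀ (κ : Measure X) [IsProbabilityMeasure κ] (f : C(X, ℝ)), Integrable f κ :=
    fun κ _ f => f.continuous.integrable_of_hasCompactSupport (HasCompactSupport.of_compactSpace _)
  have hspan : ∀ f ∈ Submodule.span ℝ (insert 1 S), ∫ x, f x ∂μ = ∫ x, f x ∂ν := by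
    intro f hf
    induction hf using Submodule.span_induction with
    | mem f hf =>
      rcases hf with rfl | hf
      · simp
      · exact h f hf
    | zero => simp
    | add f g _ _ hf hg =>
      simp only [ContinuousMap.add_apply]
      rw [integral_add (hint μ f) (hint μ g), integral_add (hint ν f) (hint ν g), hf, hg]
    | smul c f _ hf =>
      simp only [ContinuousMap.smul_apply, smul_eq_mul]
      rw [integral_const_mul, integral_const_mul, hf]
  have hclose : ∀ (κ : Measure X) [IsProbabilityMeasure κ] (f g : C(X, ℝ)),
      |∫ x, f x ∂κ - ∫ x, g x ∂κ| ≤ dist f g := by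
    intro κ _ f g
    rw [← integral_sub (hint κ f) (hint κ g), ← Real.norm_eq_abs]
    simpa using norm_integral_le_of_norm_le_const (μ := κ) (f := fun x => f x - g x)
      (Eventually.of_forall fun x => by
        rw [← dist_eq_norm]; exact ContinuousMap.dist_apply_le_dist x)
  refine ext_of_forall_integral_eq_of_IsFiniteMeasure fun f => ?_
  refine eq_of_abs_sub_le_all fun ε hε => ?_
  obtain ⟨g, hg, hd⟩ := Metric.mem_closure_iff.1 (hS f.toContinuousMap) (ε / 2) (half_pos hε)
  have h1 := abs_le.1 (hclose μ f.toContinuousMap g)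
  have h2 := abs_le.1 (hclose ν f.toContinuousMap g)
  have h3 := hspan g hg
  have h4 : ∀ κ : Measure X, ∫ x, f.toContinuousMap x ∂κ = ∫ x, f x ∂κ := fun κ => rfl
  rw [h4] at h1 h2
  rw [abs_le]
  constructor <;> linarith

end UniqueErgodicity

/-! ### Cluster counts along the orbit -/

theorem translate_subset_restrict_iff {Γ : DeloneMultiset d m} {P : Family d m} {A : Set (Space d)}
    {y : Space d} : (∀ i, translate y P i ⊆ restrict A Γ.pts i) ↔
      ∀ i, ∀ p ∈ P i, p + y ∈ A ∧ p + y ∈ Γ.pts i :=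
  mem_occ (Q := restrict A Γ.pts)

theorem clusterCount_vadd (Γ : DeloneMultiset d m) (P : Family d m) (x : Space d)
    (A : Set (Space d)) : clusterCount Γ P (x +ᵥ A) = clusterCount (-x +ᵥ Γ) P A := by
  rw [clusterCount, clusterCount]
  symm
  rw [← Set.ncard_image_of_injective _ (add_left_injective x)]
  symm
  congr 1
  ext y
  simp only [translate_subset_restrict_iff, mem_image, mem_ofPred_eq]
  simp only [pts_vadd, mem_translate]
  constructor
  · refine fun h => ⟨y - x, fun i p hp => ⟨?_, ?_⟩, sub_add_cancel y x⟩
    · obtain ⟨a, ha, e⟩ := (h i p hp).1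
      have e' : x + a = p + y := e
      rwa [show p + (y - x) = a by rw [← add_sub_assoc, ← e']; abel]
    · rw [show p + (y - x) - -x = p + y by abel]
      exact (h i p hp).2
  · rintro ⟨z, h, rfl⟩ i p hp
    refine ⟨⟨p + z, (h i p hp).1, ?_⟩, ?_⟩
    · change x + (p + z) = p + (z + x)
      abel
    · have := (h i p hp).2
      rwa [show p + z - -x = p + (z + x) by abel] at this

theorem clusterCount_translate (Γ : DeloneMultiset d m) (P : Family d m) (t : Space d)
    (A : Set (Space d)) : clusterCount Γ (translate t P) A = clusterCount Γ P A := by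
  rw [clusterCount, clusterCount, ← Set.ncard_image_of_injective _ (add_left_injective t)]
  congr 1
  ext y
  simp only [translate_translate, mem_image, mem_ofPred_eq]
  refine ⟨?_, fun h => ⟨y - t, by rwa [sub_add_cancel], sub_add_cancel y t⟩⟩
  rintro ⟨z, h, rfl⟩
  exact h

/-- Uniform cluster frequencies exist for all finite patterns: a pattern that occurs is a translate
of a cluster, and a pattern that does not occur has frequency zero. -/
theorem HasUCF.exists_freq {F : ℕ → Set (Space d)} {Γ : DeloneMultiset d m} (h : HasUCF F Γ)
    {P : Family d m} (hP : ∀ i, (P i).Finite) (hne : ∃ i, (P i).Nonempty) :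
    ∃ freq : ℝ, TendstoUniformly
      (fun n (x : Space d) => (clusterCount Γ P (x +ᵥ F n) : ℝ) / (volume (F n)).toReal)
      (fun _ => freq) atTop := by
  by_cases hocc : (occ P Γ.pts).Nonempty
  · obtain ⟨t, ht⟩ := hocc
    have := h (translate t P) (fun i => ⟨ht i, (hP i).vadd_set⟩)
      (hne.imp fun i h => h.vadd_set)
    simpa only [clusterCount_translate] using this
  · have h0 : ∀ A : Set (Space d), clusterCount Γ P A = 0 := by
      intro A
      rw [clusterCount, show {x : Space d | ∀ i, translate x P i ⊆ restrict A Γ.pts i} = ∅ from ?_,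
        ncard_empty]
      refine eq_empty_of_forall_notMem fun x hx => hocc ⟨x, fun i => (hx i).trans inter_subset_right⟩
    refine ⟨0, ?_⟩
    simp only [h0, Nat.cast_zero, zero_div]
    exact Metric.tendstoUniformly_iff.2 fun ε hε => by simp [hε]

/-- The average of a pattern sum and the normalized number of occurrences differ by an error that
tends to zero uniformly on the hull. -/
theorem exists_abs_average_sub_le {Γ : DeloneMultiset d m} (hΓ : HasFLC Γ)
    {F : ℕ → Set (Space d)} (hF : IsVanHove F) {P : Family d m}
    (hP : ∀ i, (P i).Finite) (hne : ∃ i, (P i).Nonempty) {φ : Space d → ℝ} (hφ : Continuous φ)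
    (hφc : HasCompactSupport φ) :
    ∃ e : ℕ → ℝ, Tendsto e atTop (𝓝 0) ∧ ∀ n, ∀ Δ : hull Γ,
      |average (F n) (fun Δ : hull Γ => patternSum P φ Δ.1.pts) Δ -
        (∫ x, φ x) * (clusterCount Δ.1 P (F n) / (volume (F n)).toReal)| ≤ e n := by
  obtain ⟨C, ρ, hρ, h⟩ := exists_abs_integral_patternSum_sub_le hΓ.finite_diff hP hne hφ hφc
  refine ⟨_, by simpa using (hF.tendsto_toReal hρ).const_mul C, fun n Δ => ?_⟩
  rw [average, ← mul_div_assoc, ← mul_div_assoc, ← sub_div, abs_div,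
    abs_of_pos (hF.volume_toReal_pos n)]
  exact div_le_div_of_nonneg_right (h Δ.1 (hull_diff_mem hΓ Δ.2) (F n) (hF.isBounded n)
    (hF.measurable n)) (hF.volume_toReal_pos n).le

/-! ### Unique ergodicity and cluster frequencies -/

theorem dense_orbit (Γ : DeloneMultiset d m) :
    Dense (range fun h : Space d => -h +ᵥ (⟨Γ, mem_hull_self Γ⟩ : hull Γ)) := by
  rw [Topology.IsInducing.subtypeVal.dense_iff]
  rintro ⟨Δ, hΔ⟩
  rw [hull_eq_closure] at hΔ
  rw [← range_comp]
  exact hΔ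

/-- A bound for a continuous function on the orbit of `Γ` extends to the hull by density. -/
theorem forall_abs_sub_le_of_orbit {Γ : DeloneMultiset d m} {g : hull Γ → ℝ} (hg : Continuous g)
    {a ε : ℝ} (h : ∀ x : Space d, |g (-x +ᵥ (⟨Γ, mem_hull_self Γ⟩ : hull Γ)) - a| ≤ ε)
    (Δ : hull Γ) : |g Δ - a| ≤ ε := by
  have hclosed : IsClosed {Δ : hull Γ | |g Δ - a| ≤ ε} :=
    isClosed_le (hg.sub continuous_const).abs continuous_const
  exact closure_minimal (range_subset_iff.2 h) hclosed (dense_orbit Γ Δ)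

theorem IsUniquelyErgodic.hasUCF {Γ : DeloneMultiset d m} (hΓ : HasFLC Γ)
    {F : ℕ → Set (Space d)} (hF : IsVanHove F) (h : IsUniquelyErgodic Γ) : HasUCF F Γ := by
  have : CompactSpace (hull Γ) := isCompact_iff_compactSpace.1 (isCompact_hull hΓ)
  obtain ⟨μ, -, hμ⟩ := h
  intro P hP hne
  -- A bump function of integral one, so that the comparison constant `∫ φ` disappears.
  let b : ContDiffBump (0 : Space d) := ⟨1, 2, one_pos, one_lt_two⟩
  have hφ : Continuous (b.normed volume) := b.continuous_normed
  have hφc : HasCompactSupport (b.normed volume) := b.hasCompactSupport_normed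
  set f := patternFun hΓ (fun i => (hP i).2) hne hφ hφc with hf
  obtain ⟨e, he, hcomp⟩ := exists_abs_average_sub_le hΓ hF (fun i => (hP i).2) hne hφ hφc
  refine ⟨∫ Δ, f Δ ∂μ, Metric.tendstoUniformly_iff.2 fun ε hε => ?_⟩
  filter_upwards [eventually_abs_average_sub_lt hF hμ f (half_pos hε),
    he.eventually_lt_const (half_pos hε)] with n h1 h2 x
  specialize h1 (-x +ᵥ ⟨Γ, mem_hull_self Γ⟩)
  have h3 := hcomp n (-x +ᵥ ⟨Γ, mem_hull_self Γ⟩)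
  rw [b.integral_normed, one_mul] at h3
  rw [Real.dist_eq, clusterCount_vadd]
  have h1' := abs_lt.1 h1
  have h3' := abs_le.1 (h3.trans h2.le)
  change _ ≤ average (F n) f _ - (clusterCount (-x +ᵥ Γ) P (F n) : ℝ) / _ ∧
    average (F n) f _ - (clusterCount (-x +ᵥ Γ) P (F n) : ℝ) / _ ≤ _ at h3'
  rw [abs_lt]
  constructor <;> linarith

theorem HasUCF.isUniquelyErgodic {Γ : DeloneMultiset d m} (hΓ : HasFLC Γ)
    {F : ℕ → Set (Space d)} (hF : IsVanHove F) (h : HasUCF F Γ) : IsUniquelyErgodic Γ := by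
  have : CompactSpace (hull Γ) := isCompact_iff_compactSpace.1 (isCompact_hull hΓ)
  obtain ⟨μ, hμ, -⟩ := exists_invariant_measure hF (fun _ => (⟨Γ, mem_hull_self Γ⟩ : hull Γ))
    (Ultrafilter.of atTop) (Ultrafilter.of_le _)
  have key : ∀ f ∈ patternFuns Γ, ∃ a : ℝ, ∀ ν : Measure (hull Γ),
      IsProbabilityMeasure ν ∧ VAddInvariantMeasure (Space d) (hull Γ) ν →
      ∫ Δ, f Δ ∂ν = a := by
    rintro f ⟨P, φ, hP, hne, hφ, hφc, hf⟩
    obtain ⟨a, ha⟩ := h.exists_freq hP hne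
    obtain ⟨e, he, hcomp⟩ := exists_abs_average_sub_le hΓ hF hP hne hφ hφc
    have hf' : (f : hull Γ → ℝ) = fun Δ => patternSum P φ Δ.1.pts := funext hf
    obtain ⟨c, hc⟩ : ∃ c : ℝ, c = ∫ x, φ x := ⟨_, rfl⟩
    rw [← hc] at hcomp
    refine ⟨c * a, fun ν hν => ?_⟩
    have := hν.1
    have := hν.2
    refine integral_eq_of_average hF f (fun ε hε => ?_) ν
    filter_upwards [he.eventually_lt_const (half_pos hε), Metric.tendstoUniformly_iff.1 ha
      (ε / 2 / (|c| + 1)) (by positivity)] with n h1 h2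
    refine forall_abs_sub_le_of_orbit (continuous_average (hF.volume_ne_top n) f) fun x => ?_
    have h3 := hcomp n (-x +ᵥ ⟨Γ, mem_hull_self Γ⟩)
    have h4 := (h2 x).le
    rw [Real.dist_eq, clusterCount_vadd, abs_sub_comm] at h4
    rw [← hf'] at h3
    obtain ⟨k, hk⟩ : ∃ k : ℝ, k = clusterCount (-x +ᵥ Γ) P (F n) / (volume (F n)).toReal :=
      ⟨_, rfl⟩
    rw [show (-x +ᵥ (⟨Γ, mem_hull_self Γ⟩ : hull Γ)).1 = -x +ᵥ Γ from rfl, ← hk] at h3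
    rw [← hk] at h4
    have h5 : |c * k - c * a| ≤ ε / 2 := by
      rw [← mul_sub, abs_mul]
      calc |c| * |k - a| ≤ (|c| + 1) * (ε / 2 / (|c| + 1)) := by gcongr; linarith
        _ = ε / 2 := by field_simp
    exact (abs_sub_le _ (c * k) _).trans (by linarith)
  refine ⟨μ, hμ, fun ν hν => ?_⟩
  have := hμ.1
  have := hν.1
  refine measure_eq_of_dense_span (dense_span_patternFuns hΓ) fun f hf => ?_
  obtain ⟨a, ha⟩ := key f hf
  rw [ha ν hν, ha μ hμ]

end DeloneHull

end

theorem theorem2p2 {d m : ℕ} (Γ : DeloneHull.DeloneMultiset d m) (hΓ : DeloneHull.HasFLC Γ)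
    (F : ℕ → Set (DeloneHull.Space d)) (hF : DeloneHull.IsVanHove F) :
    DeloneHull.IsUniquelyErgodic Γ ↔ DeloneHull.HasUCF F Γ :=
  ⟨fun h => h.hasUCF hΓ hF, fun h => h.isUniquelyErgodic hΓ hF⟩
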